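/- Let $n\ge 1$, and consider the $n\times n$ toroidal grid: the torus obtained from $[0,n]\times[0,n]$ by identifying opposite edges, with horizontal circles $\alpha_1,\dots,\alpha_n$ ($\alpha_i$ the image of $[0,n]\times\{i-1\}$), vertical circles $\beta_1,\dots,\beta_n$ ($\beta_i$ the image of $\{i-1\}\times[0,n]$), and $n^2$ square regions; $X_n$ is a marking in the top-right square $(n-1,n)\times(n-1,n)$. A generator $x^\sigma$ is the set of points $\alpha_{\sigma(i)}\cap\beta_i$, $1\le i\le n$, for a permutation $\sigma$ of $\{1,\dots,n\}$. A domain from a generator $x$ to a generator $y$ is an integer combination $D$ of the squares such that the part of $\partial D$ lying on the $\alpha$-circles has boundary $y-x$, and such that $D$ has coefficient $0$ at $X_n$. It is positive if all its coefficients are $\ge 0$; the set of positive domains from $x$ to $y$ is $\mathscr D^+(x,y)$. For $D\in\mathscr D^+(x,y)$ and $E\in\mathscr D^+(y,z)$, $D*E\in\mathscr D^+(x,z)$ is the sum of the 2-chains. The Maslov index is $\mu(D)=n_x(D)+n_y(D)$, where $n_x(D)$ is the sum over the points of $x$ of the average of the coefficients of $D$ in the four squares around the point. A rectangle $R\in\mathscr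 R(x,y)\subset\mathscr D^+(x,y)$ is an embedded rectangle in the torus whose bottom-left and top-right corners belong to $x$, whose bottom-right and top-left corners belong to $y$, such that the other $n-2$ points of $x$ and $y$ agree and none of them lies in $R$. The trivial domain $c_x\in\mathscr D^+(x,x)$ is the zero 2-chain. A sign assignment is a function $s:\bigcup_{x,y}\mathscr R(x,y)\to\{\pm1\}$ such that: if $R_1*S_1=R_2*S_2$ are two different decompositions into rectangles of a positive domain that is neither a horizontal annulus (row) nor a vertical annulus (column), then $s(R_1)s(S_1)=-s(R_2)s(S_2)$; if $R*S$ is a horizontal annulus, then $s(R)s(S)=1$; if $R*S$ is a vertical annulus, then $s(R)s(S)=-1$. **Proposition.** Let $s$ be a sign assignment on the $n\times n$ grid. Every positive domain avoiding $X_n$ has Maslov index in $\mathbb N$. Let $$CD_k=\mathbb Z\langle (x,y,D) : D\in\mathscr D^+(x,y),\ \mu(D)=k\rangle ,$$ and define $\delta:CD_k\to CD_{k-1}$ on a basis element $D\in\mathscr D^+(x,y)$ by $$\delta(D)=\sum_{\substack{(R,E)\in\mathscr R(x,w)\times\mathscr D^+(w,y)\\ R*E=D}} s(R)\,E+(-1)^k\sum_{\substack{(E,R)\in\mathscr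 D^+(x,w)\times\mathscr R(w,y)\\ E*R=D}} s(R)\,E .$$ Then $\delta^2=0$, $H_k(CD_*)=0$ for all $k\neq0$, and $H_0(CD_*)\cong\mathbb Z$, generated by the class of the trivial domain $c_{x^{\mathrm{Id}}}$ at the generator $x^{\mathrm{Id}}$ of the identity permutation. -/

import Mathlib

open CategoryTheory

namespace Grid

/-- Generators (states) of the grid of index `n`: the permutation `σ` is the `n`-tuple of points
`(i, σ i)`, i.e. on the `i`-th vertical circle the point on the `σ i`-th horizontal circle.
Circles, columns and rows are numbered cyclically by `Fin n`, starting from `0`. The square in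
column `c` and row `r` has the point `(c, r)` as its bottom-left corner and the points `(c + 1, r)`,
`(c, r + 1)`, `(c + 1, r + 1)` (mod `n`) as its other corners. -/
abbrev State (n : ℕ) : Type := Equiv.Perm (Fin n)

/-- 2-chains: integer combinations of the `n²` squares; `D c r` is the multiplicity in column `c`
and row `r`. -/
abbrev Chain (n : ℕ) : Type := Fin n → Fin n → ℤ

section
variable {n : ℕ} [NeZero n]

/-- The last index `n - 1`. The marking `X_n` lies in the top-right square `(last, last)`. -/
def last (n : ℕ) [NeZero n] : Fin n :=
  ⟨n - 1, Nat.sub_lt (Nat.pos_of_ne_zero (NeZero.ne n)) Nat.one_pos⟩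

/-- The coefficient at the point `(c, r)` of the boundary of the part of `∂D` that lies on the
horizontal circles. The edge from `(c, r)` to `(c + 1, r)` occurs in `∂D` with coefficient
`D c r - D c (r - 1)`. -/
def cornerBoundary (D : Chain n) (c r : Fin n) : ℤ :=
  (D (c - 1) r - D (c - 1) (r - 1)) - (D c r - D c (r - 1))

/-- The 0-chain of a state, i.e. the formal sum of its coordinates. -/
def statePoint (x : State n) (c r : Fin n) : ℤ := if x c = r then 1 else 0

/-- The 2-chain `D` is a domain from `x` to `y`: the boundary of the horizontal part of its
boundary is `y - x`. -/
def IsDomain (x y : State n) (D : Chain n) : Prop :=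
  ∀ c r, cornerBoundary D c r = statePoint y c r - statePoint x c r

/-- Sum of the multiplicities of `D` in the four squares around the point `(c, r)`. -/
def cornerSum (D : Chain n) (c r : Fin n) : ℤ :=
  D c r + D (c - 1) r + D c (r - 1) + D (c - 1) (r - 1)

/-- The point measure of `D` at `x`: the sum over the coordinates of `x` of the average
multiplicity of `D` in the four adjacent squares. -/
def pointMeasure (D : Chain n) (x : State n) : ℚ :=
  ∑ i, (cornerSum D i (x i) : ℚ) / 4

/-- A positive domain from `src` to `tgt` that avoids `X_n`; all triples `(x, y, D)` together. -/
@[ext]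
structure PosDomain (n : ℕ) [NeZero n] where
  src : State n
  tgt : State n
  chain : Chain n
  isDomain : IsDomain src tgt chain
  nonneg : ∀ c r, 0 ≤ chain c r
  avoid : chain (last n) (last n) = 0

/-- The Maslov index of a domain, by Lipshitz's formula: Euler measure plus the point measures at
the two ends. The Euler measure of a domain on a grid is zero, since each square is a
4-gon. -/
def PosDomain.maslov (D : PosDomain n) : ℚ :=
  pointMeasure D.chain D.src + pointMeasure D.chain D.tgt

/-- The trivial domain at `x`. -/
def PosDomain.const (x : State n) : PosDomain n where
  src := x
  tgt := x
  chain := fun _ _ => 0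
  isDomain := by intro c r; simp [cornerBoundary]
  nonneg := by simp
  avoid := rfl

/-- `k` lies in the cyclic half-open interval `[i, j)`. -/
def InArc (i j k : Fin n) : Prop := (k - i).val < (j - i).val

instance (i j k : Fin n) : Decidable (InArc i j k) := Nat.decLt _ _

/-- The rectangle on the torus with bottom-left corner `(i, a)` and top-right corner `(j, b)`. -/
def boxChain (i j a b : Fin n) : Chain n :=
  fun c r => if InArc i j c ∧ InArc a b r then 1 else 0

/-- A rectangle starting at the state `src` and avoiding `X_n`: its bottom-left and top-right
corners are the coordinates of `src` on the vertical circles `left` and `right`, and no other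
coordinate `(k, src k)` of `src` lies in it. (As `k ≠ left, right`, such a point lies on no side
of the rectangle, so it lies in the closed rectangle exactly if it is a bottom-left corner of
one of its squares.) -/
@[ext]
structure Rect (n : ℕ) [NeZero n] where
  src : State n
  left : Fin n
  right : Fin n
  ne : left ≠ right
  empty : ∀ k, k ≠ left → k ≠ right → boxChain left right (src left) (src right) k (src k) = 0
  avoid : boxChain left right (src left) (src right) (last n) (last n) = 0

namespace Rect

/-- The final state of a rectangle: its coordinates on the two vertical circles `left` and
`right` are the top-left and the bottom-right corner, the others agree with those of `src`. -/
def tgt (R : Rect n) : State n := Equiv.swap R.left R.right |>.trans R.src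

def chain (R : Rect n) : Chain n := boxChain R.left R.right (R.src R.left) (R.src R.right)

noncomputable instance : Fintype (Rect n) :=
  Fintype.ofInjective (fun R : Rect n => (R.src, R.left, R.right)) (by
    intro R S h
    simp only [Prod.mk.injEq] at h
    exact Rect.ext h.1 h.2.1 h.2.2)

end Rect

theorem arc_diff {i j : Fin n} (h : i ≠ j) (c : Fin n) :
    (if InArc i j c then (1 : ℤ) else 0) - (if InArc i j (c - 1) then 1 else 0)
      = (if c = i then 1 else 0) - (if c = j then 1 else 0) := by
  have hn : 0 < n := Nat.pos_of_ne_zero (NeZero.ne n)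
  have e1 : c - 1 - i = (c - i) - 1 := by abel
  have hw : (j - i).val ≠ 0 := by
    intro h0
    apply h
    have : j - i = 0 := Fin.ext (by simpa using h0)
    exact (sub_eq_zero.mp this).symm
  have hwl := (j - i).isLt
  have hul := (c - i).isLt
  have ei : c = i ↔ (c - i).val = 0 := by
    rw [← sub_eq_zero, Fin.ext_iff]; simp
  have ej : c = j ↔ (c - i).val = (j - i).val := by
    rw [← Fin.ext_iff]; simp
  have hs : ((c - i) - 1).val = if (c - i).val = 0 then n - 1 else (c - i).val - 1 := by
    have hn2 : 1 < n := by omega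
    have h1 : ((1 : Fin n)).val = 1 := by
      rw [Fin.val_one']; exact Nat.mod_eq_of_lt hn2
    rw [Fin.sub_def, h1]
    simp only
    split_ifs with h0
    · rw [h0, Nat.add_zero]; exact Nat.mod_eq_of_lt (by omega)
    · rw [show n - 1 + (c - i).val = ((c - i).val - 1) + n by omega, Nat.add_mod_right]
      exact Nat.mod_eq_of_lt (by omega)
  have hB : InArc i j (c - 1) ↔
      (if (c - i).val = 0 then n - 1 else (c - i).val - 1) < (j - i).val := by
    rw [InArc, e1, hs]
  have hA : InArc i j c ↔ (c - i).val < (j - i).val := Iff.rfl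
  clear hs e1
  rw [if_congr hA rfl rfl, if_congr ei rfl rfl, if_congr ej rfl rfl]
  clear hA ei ej
  by_cases hu : (c - i).val = 0
  · rw [if_pos hu] at hB
    rw [if_congr hB rfl rfl]
    clear hB
    split_ifs <;> first | rfl | (exfalso; omega)
  · rw [if_neg hu] at hB
    rw [if_congr hB rfl rfl]
    clear hB
    split_ifs <;> first | rfl | (exfalso; omega)

theorem boxChain_eq {m : ℕ} (i j a b c r : Fin m) : boxChain i j a b c r =
    (if InArc i j c then (1 : ℤ) else 0) * (if InArc a b r then 1 else 0) := by
  unfold boxChain; split_ifs <;> simp_all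

theorem Rect.isDomain (R : Rect n) : IsDomain R.src R.tgt R.chain := by
  intro c r
  have ha := arc_diff R.ne c
  have hb := arc_diff (R.src.injective.ne R.ne) r
  have key : cornerBoundary R.chain c r =
      - (((if c = R.left then (1 : ℤ) else 0) - (if c = R.right then 1 else 0)) *
        ((if r = R.src R.left then (1 : ℤ) else 0) - (if r = R.src R.right then 1 else 0))) := by
    rw [← ha, ← hb]
    simp only [cornerBoundary, Rect.chain, boxChain_eq]
    ring
  rw [key]
  simp only [statePoint, Rect.tgt, Equiv.trans_apply]
  by_cases h1 : c = R.left
  · subst h1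
    simp only [Equiv.swap_apply_left, if_true, R.ne, if_false, eq_comm (a := r)]
    ring
  · by_cases h2 : c = R.right
    · subst h2
      simp only [Equiv.swap_apply_right, if_true, h1, if_false, eq_comm (a := r)]
      ring
    · simp [Equiv.swap_apply_of_ne_of_ne h1 h2, h1, h2]

theorem Rect.chain_nonneg (R : Rect n) (c r : Fin n) : 0 ≤ R.chain c r := by
  unfold Rect.chain boxChain; split_ifs <;> simp

/-- A rectangle, as a positive domain. -/
def Rect.toPosDomain (R : Rect n) : PosDomain n where
  src := R.src
  tgt := R.tgt
  chain := R.chain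
  isDomain := R.isDomain
  nonneg := R.chain_nonneg
  avoid := R.avoid

theorem Rect.maslov_eq_one (R : Rect n) : R.toPosDomain.maslov = 1 := by
  have hs : ∀ c r, cornerSum R.chain c r =
      ((if InArc R.left R.right c then (1 : ℤ) else 0) +
        (if InArc R.left R.right (c - 1) then 1 else 0)) *
      ((if InArc (R.src R.left) (R.src R.right) r then (1 : ℤ) else 0) +
        (if InArc (R.src R.left) (R.src R.right) (r - 1) then 1 else 0)) := by
    intro c r; simp only [cornerSum, Rect.chain, boxChain_eq]; ring
  have endl : ∀ {i j : Fin n}, i ≠ j → (if InArc i j i then (1 : ℤ) else 0) +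
      (if InArc i j (i - 1) then 1 else 0) = 1 := by
    intro i j h
    have := arc_diff h i
    simp only [if_true, h, if_false] at this
    split_ifs at * <;> simp_all
  have endr : ∀ {i j : Fin n}, i ≠ j → (if InArc i j j then (1 : ℤ) else 0) +
      (if InArc i j (j - 1) then 1 else 0) = 1 := by
    intro i j h
    have := arc_diff h j
    simp only [if_true, h.symm, if_false] at this
    split_ifs at * <;> simp_all
  have hne' := R.src.injective.ne R.ne
  have mid : ∀ k, k ≠ R.left → k ≠ R.right → cornerSum R.chain k (R.src k) = 0 := by
    intro k h1 h2
    have ha := arc_diff R.ne k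
    have hb := arc_diff hne' (R.src k)
    have he := R.empty k h1 h2
    rw [boxChain_eq] at he
    simp only [h1, h2, R.src.injective.ne h1, R.src.injective.ne h2, if_false] at ha hb
    rw [hs]
    have ha' := sub_eq_zero.mp (ha.trans (sub_zero 0))
    have hb' := sub_eq_zero.mp (hb.trans (sub_zero 0))
    rw [← ha', ← hb']
    linear_combination 4 * he
  have hx : pointMeasure R.chain R.src = 1 / 2 := by
    unfold pointMeasure
    rw [Fintype.sum_eq_add R.left R.right R.ne (by
      rintro k ⟨h1, h2⟩; rw [mid k h1 h2]; simp)]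
    rw [hs, hs, endl R.ne, endr R.ne, endl hne', endr hne']
    norm_num
  have hy : pointMeasure R.chain R.tgt = 1 / 2 := by
    unfold pointMeasure
    rw [Fintype.sum_eq_add R.left R.right R.ne (by
      rintro k ⟨h1, h2⟩
      have : R.tgt k = R.src k := by simp [Rect.tgt, Equiv.swap_apply_of_ne_of_ne h1 h2]
      rw [this, mid k h1 h2]; simp)]
    have e1 : R.tgt R.left = R.src R.right := by simp [Rect.tgt]
    have e2 : R.tgt R.right = R.src R.left := by simp [Rect.tgt]
    rw [e1, e2, hs, hs, endl R.ne, endr R.ne, endl hne', endr hne']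
    norm_num
  change pointMeasure R.chain R.src + pointMeasure R.chain R.tgt = 1
  rw [hx, hy]; norm_num

theorem cornerBoundary_symm (F G : Chain n) :
    ∑ c, ∑ r, cornerBoundary F c r * cornerSum G c r =
      ∑ c, ∑ r, cornerBoundary G c r * cornerSum F c r := by
  have sh : ∀ f : Fin n → ℤ, ∑ c, f (c - 1) = ∑ c, f c := fun f =>
    Equiv.sum_comp (Equiv.subRight (1 : Fin n)) f
  let U : Fin n → Fin n → ℤ := fun c r => F (c - 1) r * G c r - F c r * G (c - 1) r
  let W : Fin n → Fin n → ℤ := fun c r => F c (r - 1) * G c r - F c r * G c (r - 1)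
  have hU : ∑ c, ∑ r, (U c r - U c (r - 1)) = 0 := by
    refine Finset.sum_eq_zero fun c _ => ?_
    rw [Finset.sum_sub_distrib, sh (U c), sub_self]
  have hW : ∑ c, ∑ r, (W c r - W (c - 1) r) = 0 := by
    rw [Finset.sum_comm]
    refine Finset.sum_eq_zero fun r _ => ?_
    rw [Finset.sum_sub_distrib, sh (fun c => W c r), sub_self]
  have hd : ∑ c, ∑ r, (cornerBoundary F c r * cornerSum G c r -
      cornerBoundary G c r * cornerSum F c r) =
      2 * (∑ c, ∑ r, (U c r - U c (r - 1)) + ∑ c, ∑ r, (W c r - W (c - 1) r)) := by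
    simp only [← Finset.sum_add_distrib, Finset.mul_sum]
    refine Finset.sum_congr rfl fun c _ => Finset.sum_congr rfl fun r _ => ?_
    simp only [U, W, cornerBoundary, cornerSum]
    ring
  rw [hU, hW] at hd
  simp only [Finset.sum_sub_distrib] at hd
  linarith

theorem pointMeasure_sub {x y : State n} {D : Chain n} (h : IsDomain x y D) (E : Chain n) :
    pointMeasure E y - pointMeasure E x =
      ((∑ c, ∑ r, cornerBoundary D c r * cornerSum E c r : ℤ) : ℚ) / 4 := by
  have hp : ∀ z : State n, pointMeasure E z =
      ((∑ c, ∑ r, statePoint z c r * cornerSum E c r : ℤ) : ℚ) / 4 := by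
    intro z
    simp [pointMeasure, statePoint, Finset.sum_div]
  have hq : ∑ c, ∑ r, cornerBoundary D c r * cornerSum E c r =
      ∑ c, ∑ r, statePoint y c r * cornerSum E c r -
        ∑ c, ∑ r, statePoint x c r * cornerSum E c r := by
    simp only [← Finset.sum_sub_distrib, ← sub_mul, h _ _]
  rw [hp, hp, hq]
  push_cast
  ring

/-- Additivity of the Maslov index: if the underlying chain of `F` is the sum of those of `D` and
`E`, and the ends match, then `μ(F) = μ(D) + μ(E)`. -/
theorem PosDomain.maslov_add {D E F : PosDomain n} (h1 : F.src = D.src) (h2 : D.tgt = E.src)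
    (h3 : F.tgt = E.tgt) (h : ∀ c r, F.chain c r = D.chain c r + E.chain c r) :
    F.maslov = D.maslov + E.maslov := by
  have hadd : ∀ z, pointMeasure F.chain z = pointMeasure D.chain z + pointMeasure E.chain z := by
    intro z
    simp only [pointMeasure, ← Finset.sum_add_distrib, cornerSum, h]
    refine Finset.sum_congr rfl fun i _ => ?_
    push_cast; ring
  have hD := pointMeasure_sub D.isDomain E.chain
  have hE := pointMeasure_sub E.isDomain D.chain
  rw [cornerBoundary_symm] at hD
  unfold PosDomain.maslov
  rw [hadd, hadd, h1, h3, h2] at *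
  linarith

theorem IsDomain.sub {x y z w : State n} {D R : Chain n} (hD : IsDomain x y D)
    (hR : IsDomain z w R) (c r : Fin n) :
    cornerBoundary (fun c r => D c r - R c r) c r =
      (statePoint y c r - statePoint x c r) - (statePoint w c r - statePoint z c r) := by
  rw [← hD c r, ← hR c r]; simp only [cornerBoundary]; ring

/-- `R` is an initial rectangle of `D`: `D = R * E` for a (unique) positive domain `E`. -/
def Rect.IsInitial (R : Rect n) (D : PosDomain n) : Prop :=
  R.src = D.src ∧ ∀ c r, R.chain c r ≤ D.chain c r

/-- `R` is a final rectangle of `D`: `D = E * R` for a (unique) positive domain `E`. -/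
def Rect.IsFinal (R : Rect n) (D : PosDomain n) : Prop :=
  R.tgt = D.tgt ∧ ∀ c r, R.chain c r ≤ D.chain c r

/-- The positive domain `E` with `D = R * E`. -/
def PosDomain.removeInitial (D : PosDomain n) (R : Rect n) (h : R.IsInitial D) : PosDomain n where
  src := R.tgt
  tgt := D.tgt
  chain := fun c r => D.chain c r - R.chain c r
  isDomain := by
    intro c r
    rw [D.isDomain.sub R.isDomain, h.1]; ring
  nonneg := fun c r => sub_nonneg.mpr (h.2 c r)
  avoid := by rw [D.avoid, show R.chain (last n) (last n) = 0 from R.avoid, sub_zero]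

/-- The positive domain `E` with `D = E * R`. -/
def PosDomain.removeFinal (D : PosDomain n) (R : Rect n) (h : R.IsFinal D) : PosDomain n where
  src := D.src
  tgt := R.src
  chain := fun c r => D.chain c r - R.chain c r
  isDomain := by
    intro c r
    rw [D.isDomain.sub R.isDomain, h.1]; ring
  nonneg := fun c r => sub_nonneg.mpr (h.2 c r)
  avoid := by rw [D.avoid, show R.chain (last n) (last n) = 0 from R.avoid, sub_zero]

theorem PosDomain.maslov_removeInitial (D : PosDomain n) (R : Rect n) (h : R.IsInitial D) :
    D.maslov = 1 + (D.removeInitial R h).maslov := by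
  rw [← R.maslov_eq_one]
  refine PosDomain.maslov_add h.1.symm rfl rfl fun c r => ?_
  change _ = R.chain c r + (D.chain c r - R.chain c r)
  ring

theorem PosDomain.maslov_removeFinal (D : PosDomain n) (R : Rect n) (h : R.IsFinal D) :
    D.maslov = (D.removeFinal R h).maslov + 1 := by
  rw [← R.maslov_eq_one]
  refine PosDomain.maslov_add rfl rfl h.1.symm fun c r => ?_
  change _ = (D.chain c r - R.chain c r) + R.chain c r
  ring

/-- The 2-chain `D` is a horizontal annulus (a row). -/
def IsHorizontalAnnulus (D : Chain n) : Prop :=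
  ∃ i, ∀ c r, D c r = if r = i then 1 else 0

/-- The 2-chain `D` is a vertical annulus (a column). -/
def IsVerticalAnnulus (D : Chain n) : Prop :=
  ∃ i, ∀ c r, D c r = if c = i then 1 else 0

/-- A sign assignment on the rectangles that avoid `X_n`. -/
structure SignAssignment (n : ℕ) [NeZero n] where
  sign : Rect n → ℤˣ
  /-- The two decompositions `R₁ * S₁ = R₂ * S₂` of an index-2 positive domain that is not an
  annulus have opposite signs. -/
  anticomm : ∀ R₁ S₁ R₂ S₂ : Rect n, R₁.tgt = S₁.src → R₂.tgt = S₂.src →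
    R₁.src = R₂.src → S₁.tgt = S₂.tgt → R₁.chain + S₁.chain = R₂.chain + S₂.chain →
    ¬ IsHorizontalAnnulus (R₁.chain + S₁.chain) → ¬ IsVerticalAnnulus (R₁.chain + S₁.chain) →
    (R₁, S₁) ≠ (R₂, S₂) → sign R₁ * sign S₁ = -(sign R₂ * sign S₂)
  horizontal : ∀ R S : Rect n, R.tgt = S.src →
    IsHorizontalAnnulus (R.chain + S.chain) → sign R * sign S = 1
  vertical : ∀ R S : Rect n, R.tgt = S.src →
    IsVerticalAnnulus (R.chain + S.chain) → sign R * sign S = -1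

/-- The positive domains of Maslov index `k`. -/
abbrev Basis (n : ℕ) [NeZero n] (k : ℕ) : Type := {D : PosDomain n // D.maslov = k}

/-- The chain group `CD_k`: the free abelian group on the positive domains of Maslov index `k`. -/
abbrev CD (n : ℕ) [NeZero n] (k : ℕ) : Type := Basis n k →₀ ℤ

def Basis.removeInitial {k : ℕ} (D : Basis n (k + 1)) (R : Rect n) (h : R.IsInitial D.1) :
    Basis n k :=
  ⟨D.1.removeInitial R h, by
    have h1 := D.1.maslov_removeInitial R h
    have h2 := D.2
    push_cast at h2
    linarith⟩

def Basis.removeFinal {k : ℕ} (D : Basis n (k + 1)) (R : Rect n) (h : R.IsFinal D.1) :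
    Basis n k :=
  ⟨D.1.removeFinal R h, by
    have h1 := D.1.maslov_removeFinal R h
    have h2 := D.2
    push_cast at h2
    linarith⟩

open Classical in
/-- The value of the differential on a positive domain `D` of index `k + 1`:
`∑_{R * E = D} s(R) E + (-1)^(k + 1) ∑_{E * R = D} s(R) E`. -/
noncomputable def deltaBasis (s : SignAssignment n) (k : ℕ) (D : Basis n (k + 1)) : CD n k :=
  (∑ R : Rect n, if h : R.IsInitial D.1 then
      Finsupp.single (D.removeInitial R h) ((s.sign R : ℤˣ) : ℤ) else 0) +
  (-1 : ℤ) ^ (k + 1) • ∑ R : Rect n, if h : R.IsFinal D.1 then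
      Finsupp.single (D.removeFinal R h) ((s.sign R : ℤˣ) : ℤ) else 0

/-- The differential `δ : CD_{k+1} → CD_k`. -/
noncomputable def delta (s : SignAssignment n) (k : ℕ) : CD n (k + 1) →ₗ[ℤ] CD n k :=
  Finsupp.linearCombination ℤ (deltaBasis s k)

/-- The complex of positive domains, given that `δ² = 0`. -/
noncomputable def complex (s : SignAssignment n)
    (h : ∀ k, delta s k ∘ₗ delta s (k + 1) = 0) : ChainComplex (ModuleCat ℤ) ℕ :=
  ChainComplex.of (fun k => ModuleCat.of ℤ (CD n k)) (fun k => ModuleCat.ofHom (delta s k))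
    (fun k => by rw [← ModuleCat.ofHom_comp, h k]; rfl)

theorem PosDomain.maslov_const (x : State n) : (PosDomain.const x).maslov = (0 : ℕ) := by
  simp [PosDomain.maslov, pointMeasure, cornerSum, PosDomain.const]

/-- The trivial domain at `x`, as an element of `CD_0`. -/
noncomputable def constChain (x : State n) : CD n 0 :=
  Finsupp.single ⟨PosDomain.const x, PosDomain.maslov_const x⟩ 1

end

end Grid

/-! Two independent arguments carry the result, one for `δ² = 0` and one for the homology.

Expanding `δ²` removes two rectangles from the front, two from the back, or one at each end. The
mixed terms cancel because of the sign `(-1)^k`. If a composite `R * S` is not an annulus, the same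
region has a second decomposition (`exists_alternative`), which comes with the opposite sign. Each
row or column other than the last one decomposes in exactly one way from each state, so the annuli
contribute the same element at the front and at the back, and these two contributions have opposite
signs.

The homology is computed by a discrete Morse matching. Let `y` be the final state of a domain, `t`
its top row and `u` its right column. In each row, the second difference of the coefficients at
column `i` is determined by `t` and the two end states (`bump_eq`). So there is a condition on `y`
and `t` alone (`Splits`) under which a positive domain whose initial state ascends at `i` must
contain the rectangle of width one in column `i` (`one_le_of_splits`); transposing gives the same
for rows. This rectangle avoids the top row and the right column, so removing it keeps `y`, `t`, `u`
and turns the ascent into a descent. Fixing a splitting line for each `(y, t, u)` that has one pairs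
the ascending (upper) domains with the descending (lower) ones. Without a splitting line, a maximum
principle gives `t = u = 0`, the absence of descents gives `y = Id`, and an area count leaves only
the trivial domain (`eq_const_of_line_eq_none`).

Removing an initial rectangle that avoids the top row and right column preserves the rank of a
domain; every other removal lowers it. Among the rank-preserving removals from an upper domain, only
that of the thin rectangle reaches a lower domain (`eq_thin_or_rank_lt`). Hence the upper-to-lower
part of `δ` is unitriangular with signs on the diagonal, and it is bijective because ranks are well
founded and supports finite. Only the trivial domain at the identity survives.

The index is an integer because thin rectangles of index 1 connect every state to the identity, and
two domains with the same ends differ by rows and columns, whose point measures are integers. -/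

namespace Grid
variable {n : ℕ}

/-! ### Cyclic intervals -/

theorem val_sub_eq (k i : Fin n) :
    (k - i).val = if i.val ≤ k.val then k.val - i.val else n + k.val - i.val := by
  rw [Fin.sub_def]
  have := k.isLt
  have := i.isLt
  simp only
  split_ifs with h
  · rw [show n - i.val + k.val = (k.val - i.val) + n by omega, Nat.add_mod_right]
    exact Nat.mod_eq_of_lt (by omega)
  · rw [show n - i.val + k.val = n + k.val - i.val by omega]
    exact Nat.mod_eq_of_lt (by omega)

theorem inArc_iff (i j k : Fin n) : InArc i j k ↔
    (i.val ≤ j.val ∧ i.val ≤ k.val ∧ k.val < j.val) ∨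
      (j.val < i.val ∧ (i.val ≤ k.val ∨ k.val < j.val)) := by
  have := k.isLt
  have := i.isLt
  have := j.isLt
  rw [InArc, val_sub_eq, val_sub_eq]
  split_ifs <;> omega

/-- The indicator function of the cyclic interval `[i, j)`. -/
def arcInd (i j k : Fin n) : ℤ := if InArc i j k then 1 else 0

theorem boxChain_eq_arcInd (i j a b c r : Fin n) :
    boxChain i j a b c r = arcInd i j c * arcInd a b r := boxChain_eq i j a b c r

theorem boxChain_nonneg (i j a b c r : Fin n) : 0 ≤ boxChain i j a b c r := by
  unfold boxChain; split_ifs <;> simp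

theorem boxChain_eq_zero_iff (i j a b c r : Fin n) :
    boxChain i j a b c r = 0 ↔ ¬ (InArc i j c ∧ InArc a b r) := by
  unfold boxChain; split_ifs with h <;> simp [h]

/-- Cutting an arc at one of its points is the only identity needed to compare two dissections of an
L-shaped region; the rest is `ring`. -/
theorem arcInd_add {i j m : Fin n} (h : InArc i m j) (k : Fin n) :
    arcInd i m k = arcInd i j k + arcInd j m k := by
  have h1 := inArc_iff i m k
  have h2 := inArc_iff i j k
  have h3 := inArc_iff j m k
  rw [inArc_iff] at h
  unfold arcInd
  rw [if_congr h1 rfl rfl, if_congr h2 rfl rfl, if_congr h3 rfl rfl]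
  clear h1 h2 h3
  split_ifs <;> first | rfl | (exfalso; omega)

theorem not_inArc_of_inArc {i j m : Fin n} (h : InArc i m j) : ¬ InArc i j m := by
  rw [inArc_iff] at *
  omega

theorem inArc_of_not_inArc {i j m : Fin n} (hij : i ≠ j) (him : i ≠ m) (hjm : j ≠ m)
    (h : ¬ InArc i m j) : InArc i j m := by
  have := Fin.val_ne_of_ne hij
  have := Fin.val_ne_of_ne him
  have := Fin.val_ne_of_ne hjm
  rw [inArc_iff] at *
  omega

theorem inArc_rotate {i j m : Fin n} (hij : i ≠ j) (him : i ≠ m) (hjm : j ≠ m)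
    (h : ¬ InArc j m i) : InArc i m j := by
  have := Fin.val_ne_of_ne hij
  have := Fin.val_ne_of_ne him
  have := Fin.val_ne_of_ne hjm
  rw [inArc_iff] at *
  omega

theorem inArc_left {i j : Fin n} (h : i ≠ j) : InArc i j i := by
  have := Fin.val_ne_of_ne h
  rw [inArc_iff]; omega

theorem not_inArc_right (i j : Fin n) : ¬ InArc i j j := by
  rw [inArc_iff]; omega

theorem arcInd_compl {i j : Fin n} (h : i ≠ j) (k : Fin n) : arcInd i j k + arcInd j i k = 1 := by
  have h2 := inArc_iff i j k
  have h3 := inArc_iff j i k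
  have := Fin.val_ne_of_ne h
  unfold arcInd
  rw [if_congr h2 rfl rfl, if_congr h3 rfl rfl]
  clear h2 h3
  split_ifs <;> first | rfl | (exfalso; omega)

variable [NeZero n]

/-! ### Second decompositions of a composite of two rectangles -/

theorem cornerBoundary_add (D E : Chain n) (c r : Fin n) :
    cornerBoundary (D + E) c r = cornerBoundary D c r + cornerBoundary E c r := by
  simp only [cornerBoundary, Pi.add_apply]; ring

theorem IsDomain.add {x y z : State n} {D E : Chain n} (hD : IsDomain x y D)
    (hE : IsDomain y z E) : IsDomain x z (D + E) := fun c r => by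
  rw [cornerBoundary_add, hD, hE]; ring

omit [NeZero n] in
theorem statePoint_injective {x y : State n} (h : ∀ c r, statePoint x c r = statePoint y c r) :
    x = y := by
  refine Equiv.ext fun c => ?_
  have := h c (x c)
  simp only [statePoint, if_true] at this
  by_contra hc
  rw [if_neg (Ne.symm hc)] at this
  exact one_ne_zero this

/-- Because of this, two decompositions with the same initial state and the same chain automatically
have the same final state. -/
theorem IsDomain.tgt_unique {x y z : State n} {D : Chain n} (hD : IsDomain x y D)
    (hE : IsDomain x z D) : y = z :=
  statePoint_injective fun c r => by have := hD c r; have := hE c r; linarith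

theorem Rect.isDomain_add {R S : Rect n} (h : R.tgt = S.src) :
    IsDomain R.src S.tgt (R.chain + S.chain) :=
  R.isDomain.add (h ▸ S.isDomain)

/-- To build a second decomposition of a composite of rectangles it is enough to give the vertical
sides, to compare the chains, and to check emptiness at the four columns involved. -/
theorem exists_alternative_of {R S : Rect n} (h : R.tgt = S.src) (p q p' q' : Fin n)
    (hpq : p ≠ q) (hpq' : p' ≠ q') (hne : (p, q) ≠ (R.left, R.right))
    (hp : p = R.left ∨ p = R.right ∨ p = S.left ∨ p = S.right)
    (hq : q = R.left ∨ q = R.right ∨ q = S.left ∨ q = S.right)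
    (hchain : ∀ c r, boxChain p q (R.src p) (R.src q) c r +
      boxChain p' q' ((Equiv.swap p q).trans R.src p') ((Equiv.swap p q).trans R.src q') c r =
        R.chain c r + S.chain c r)
    (he : ∀ k, k = R.left ∨ k = R.right ∨ k = S.left ∨ k = S.right → k ≠ p → k ≠ q →
      boxChain p q (R.src p) (R.src q) k (R.src k) = 0)
    (he' : ∀ k, k = R.left ∨ k = R.right ∨ k = S.left ∨ k = S.right → k ≠ p' → k ≠ q' →
      boxChain p' q' ((Equiv.swap p q).trans R.src p') ((Equiv.swap p q).trans R.src q') k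
        ((Equiv.swap p q).trans R.src k) = 0) :
    ∃ R' S' : Rect n, R'.tgt = S'.src ∧ R'.src = R.src ∧ S'.tgt = S.tgt ∧
      R'.chain + S'.chain = R.chain + S.chain ∧ (R', S') ≠ (R, S) := by
  -- Points on other columns need no separate check: both old rectangles miss them, and the new
  -- chains are nonnegative with the same sum.
  have gen : ∀ k, ¬ (k = R.left ∨ k = R.right ∨ k = S.left ∨ k = S.right) →
      R.chain k (R.src k) + S.chain k (R.src k) = 0 := by
    intro k hk
    push Not at hk
    have h1 := R.empty k hk.1 hk.2.1
    have h2 := S.empty k hk.2.2.1 hk.2.2.2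
    have h3 : S.src k = R.src k := by
      rw [← h, Rect.tgt, Equiv.trans_apply, Equiv.swap_apply_of_ne_of_ne hk.1 hk.2.1]
    rw [h3] at h2
    rw [Rect.chain, Rect.chain, h1, h2, add_zero]
  have av : R.chain (last n) (last n) + S.chain (last n) (last n) = 0 := by
    rw [show R.chain (last n) (last n) = 0 from R.avoid,
      show S.chain (last n) (last n) = 0 from S.avoid, add_zero]
  have both : ∀ c r, R.chain c r + S.chain c r = 0 →
      boxChain p q (R.src p) (R.src q) c r = 0 ∧ boxChain p' q'
        ((Equiv.swap p q).trans R.src p') ((Equiv.swap p q).trans R.src q') c r = 0 := by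
    intro c r h0
    have := hchain c r
    have h1 := boxChain_nonneg p q (R.src p) (R.src q) c r
    have h2 := boxChain_nonneg p' q' ((Equiv.swap p q).trans R.src p')
      ((Equiv.swap p q).trans R.src q') c r
    constructor <;> linarith
  let R' : Rect n :=
    { src := R.src
      left := p
      right := q
      ne := hpq
      empty := fun k h1 h2 => by
        by_cases hk : k = R.left ∨ k = R.right ∨ k = S.left ∨ k = S.right
        · exact he k hk h1 h2
        · exact (both _ _ (gen k hk)).1
      avoid := (both _ _ av).1 }
  let S' : Rect n :=
    { src := (Equiv.swap p q).trans R.src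
      left := p'
      right := q'
      ne := hpq'
      empty := fun k h1 h2 => by
        by_cases hk : k = R.left ∨ k = R.right ∨ k = S.left ∨ k = S.right
        · exact he' k hk h1 h2
        · have hkp : k ≠ p := by rintro rfl; exact hk hp
          have hkq : k ≠ q := by rintro rfl; exact hk hq
          have := (both _ _ (gen k hk)).2
          simpa [Equiv.swap_apply_of_ne_of_ne hkp hkq] using this
      avoid := (both _ _ av).2 }
  have hc : R'.chain + S'.chain = R.chain + S.chain := funext fun c => funext fun r => hchain c r
  have hd := Rect.isDomain_add (R := R') (S := S') rfl
  rw [hc] at hd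
  refine ⟨R', S', rfl, rfl, hd.tgt_unique (Rect.isDomain_add h), hc, fun e => hne ?_⟩
  have e1 := congrArg Prod.fst e
  exact Prod.ext (congrArg Rect.left e1) (congrArg Rect.right e1)


omit [NeZero n] in
theorem InArc.exit {i j k l : Fin n} (hk : InArc i j k) (hl : ¬ InArc i j l) (h : l ≠ j) :
    InArc k l j := by
  have := Fin.val_ne_of_ne h
  rw [inArc_iff] at *
  omega

omit [NeZero n] in
theorem InArc.rotate {i j m : Fin n} (h : InArc m i j) (hj : j ≠ i) (hm : j ≠ m) :
    InArc i j m := by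
  have := Fin.val_ne_of_ne hj
  have := Fin.val_ne_of_ne hm
  rw [inArc_iff] at *
  omega

omit [NeZero n] in
theorem InArc.enter {i j k l : Fin n} (hl : InArc i j l) (hk : ¬ InArc i j k) (h : l ≠ i) :
    InArc k l i := by
  have := Fin.val_ne_of_ne h
  rw [inArc_iff] at *
  omega

/-- Second decompositions for two rectangles on three columns; `i, j` are the columns of the first
rectangle, `m` is the third one. -/
theorem exists_alternative_three {R S : Rect n} (h : R.tgt = S.src) (m p q p' q' : Fin n)
    (hpq : p ≠ q) (hpq' : p' ≠ q') (hne : (p, q) ≠ (R.left, R.right))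
    (hm : S.left = m ∨ S.right = m)
    (hS : S.left = R.left ∨ S.left = R.right ∨ S.left = m)
    (hS' : S.right = R.left ∨ S.right = R.right ∨ S.right = m)
    (hp : p = R.left ∨ p = R.right ∨ p = m) (hq : q = R.left ∨ q = R.right ∨ q = m)
    (hchain : ∀ c r, arcInd p q c * arcInd (R.src p) (R.src q) r +
      arcInd p' q' c * arcInd (R.src (Equiv.swap p q p')) (R.src (Equiv.swap p q q')) r =
      arcInd R.left R.right c * arcInd (R.src R.left) (R.src R.right) r +
      arcInd S.left S.right c * arcInd (R.src (Equiv.swap R.left R.right S.left))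
        (R.src (Equiv.swap R.left R.right S.right)) r)
    (he : ∀ k, k = R.left ∨ k = R.right ∨ k = m → k ≠ p → k ≠ q →
      ¬ (InArc p q k ∧ InArc (R.src p) (R.src q) (R.src k)))
    (he' : ∀ k, k = R.left ∨ k = R.right ∨ k = m → k ≠ p' → k ≠ q' →
      ¬ (InArc p' q' k ∧ InArc (R.src (Equiv.swap p q p')) (R.src (Equiv.swap p q q'))
        (R.src (Equiv.swap p q k)))) :
    ∃ R' S' : Rect n, R'.tgt = S'.src ∧ R'.src = R.src ∧ S'.tgt = S.tgt ∧
      R'.chain + S'.chain = R.chain + S.chain ∧ (R', S') ≠ (R, S) := by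
  have hS2 : S.chain = boxChain S.left S.right (R.src (Equiv.swap R.left R.right S.left))
      (R.src (Equiv.swap R.left R.right S.right)) := by
    rw [Rect.chain, ← h]; rfl
  have key : ∀ k, k = R.left ∨ k = R.right ∨ k = S.left ∨ k = S.right →
      k = R.left ∨ k = R.right ∨ k = m := by
    rintro k (e | e | e | e)
    · exact .inl e
    · exact .inr (.inl e)
    · rw [e]; exact hS
    · rw [e]; exact hS'
  have key' : ∀ k, k = R.left ∨ k = R.right ∨ k = m →
      k = R.left ∨ k = R.right ∨ k = S.left ∨ k = S.right := by
    rintro k (e | e | e)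
    · exact .inl e
    · exact .inr (.inl e)
    · rcases hm with hm | hm
      · exact .inr (.inr (.inl (e.trans hm.symm)))
      · exact .inr (.inr (.inr (e.trans hm.symm)))
  refine exists_alternative_of h p q p' q' hpq hpq' hne (key' p hp) (key' q hq) ?_ ?_ ?_
  · intro c r
    rw [hS2, Rect.chain]
    simp only [boxChain_eq_arcInd, Equiv.trans_apply]
    exact hchain c r
  · intro k hk h1 h2
    rw [boxChain_eq_zero_iff]
    exact he k (key k hk) h1 h2
  · intro k hk h1 h2
    rw [boxChain_eq_zero_iff]
    exact he' k (key k hk) h1 h2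

section
variable {R S : Rect n} (h : R.tgt = S.src)
include h

theorem Rect.src_eq_of_tgt_eq (k : Fin n) : S.src k = R.src (Equiv.swap R.left R.right k) := by
  rw [← h]; rfl

/-- The same two rectangles are taken in the opposite order. If a corner of one lay inside the
other, emptiness would keep the two neighbouring corners out, and then the two rectangles would
overlap corner to corner, putting a corner of the other rectangle into the first, again against
emptiness. -/
theorem exists_alternative_disjoint (h1 : S.left ≠ R.left) (h2 : S.left ≠ R.right)
    (h3 : S.right ≠ R.left) (h4 : S.right ≠ R.right) :
    ∃ R' S' : Rect n, R'.tgt = S'.src ∧ R'.src = R.src ∧ S'.tgt = S.tgt ∧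
      R'.chain + S'.chain = R.chain + S.chain ∧ (R', S') ≠ (R, S) := by
  have src := Rect.src_eq_of_tgt_eq h
  have el : S.src S.left = R.src S.left := by rw [src, Equiv.swap_apply_of_ne_of_ne h1 h2]
  have er : S.src S.right = R.src S.right := by rw [src, Equiv.swap_apply_of_ne_of_ne h3 h4]
  have fl : ((Equiv.swap S.left S.right).trans R.src) R.left = R.src R.left := by
    rw [Equiv.trans_apply, Equiv.swap_apply_of_ne_of_ne h1.symm h3.symm]
  have fr : ((Equiv.swap S.left S.right).trans R.src) R.right = R.src R.right := by
    rw [Equiv.trans_apply, Equiv.swap_apply_of_ne_of_ne h2.symm h4.symm]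
  have Rl := R.empty _ h1 h2
  have Rr := R.empty _ h3 h4
  have Sl := S.empty _ h1.symm h3.symm
  have Sr := S.empty _ h2.symm h4.symm
  rw [src R.left, Equiv.swap_apply_left, el, er] at Sl
  rw [src R.right, Equiv.swap_apply_right, el, er] at Sr
  have inj := R.src.injective
  rw [boxChain_eq_zero_iff] at Rl Rr Sl Sr
  have n1 := inj.ne h1
  have n2 := inj.ne h2
  have n3 := inj.ne h3
  have n4 := inj.ne h4
  refine exists_alternative_of h S.left S.right R.left R.right S.ne R.ne ?_ (by simp) (by simp)
    ?_ ?_ ?_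
  · intro e; exact h1 (congrArg Prod.fst e)
  · intro c r
    rw [fl, fr, Rect.chain, Rect.chain, el, er, add_comm]
  · rintro k hk k1 k2
    rw [boxChain_eq_zero_iff]
    rintro ⟨ha, hb⟩
    rcases hk with rfl | rfl | rfl | rfl
    · exact Rr ⟨ha.exit (fun e => Sr ⟨e, hb⟩) h4.symm, hb.exit (fun e => Sl ⟨ha, e⟩) n4.symm⟩
    · exact Rl ⟨ha.enter (fun e => Sl ⟨e, hb⟩) h2.symm, hb.enter (fun e => Sr ⟨ha, e⟩) n2.symm⟩
    · exact absurd rfl k1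
    · exact absurd rfl k2
  · rintro k hk k1 k2
    rw [fl, fr, boxChain_eq_zero_iff, Equiv.trans_apply]
    rintro ⟨ha, hb⟩
    rcases hk with rfl | rfl | rfl | rfl
    · exact absurd rfl k1
    · exact absurd rfl k2
    · rw [Equiv.swap_apply_left] at hb
      exact Sr ⟨ha.exit (fun e => Rr ⟨e, hb⟩) h4, hb.enter (fun e => Rl ⟨ha, e⟩) n3⟩
    · rw [Equiv.swap_apply_right] at hb
      exact Sl ⟨ha.enter (fun e => Rl ⟨e, hb⟩) h3, hb.exit (fun e => Rr ⟨ha, e⟩) n4⟩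

/-- Here `S` sits on top of `R` with the left sides aligned, forming an L-shape. The second
decomposition cuts it at the reentrant corner in the other direction. The cyclic order of the three
columns tells which rectangle is wider; emptiness then forces the cyclic order of the three rows.
The three lemmas that follow treat the other positions of the L-shape. -/
theorem exists_alternative_left_left (h1 : S.left = R.left) (hm : S.right ≠ R.right) :
    ∃ R' S' : Rect n, R'.tgt = S'.src ∧ R'.src = R.src ∧ S'.tgt = S.tgt ∧
      R'.chain + S'.chain = R.chain + S.chain ∧ (R', S') ≠ (R, S) := by
  have hmi : S.right ≠ R.left := fun e => S.ne (h1.trans e.symm)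
  have src := Rect.src_eq_of_tgt_eq h
  have inj := R.src.injective
  have E := S.empty R.right (fun e => R.ne (h1.symm.trans e.symm)) hm.symm
  have E' := R.empty S.right hmi hm
  have hij := R.ne
  have sm := Equiv.swap_apply_of_ne_of_ne hmi hm
  simp only [src, h1, Equiv.swap_apply_left, Equiv.swap_apply_right, sm] at E
  rw [boxChain_eq_zero_iff] at E E'
  have three := exists_alternative_three h S.right
  simp only [h1, Equiv.swap_apply_left, sm] at three
  generalize S.right = m at *
  generalize R.left = i at *
  generalize R.right = j at *
  have him : i ≠ m := hmi.symm
  have hjm : j ≠ m := hm.symm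
  have hab := inj.ne hij
  have hac := inj.ne him
  have hbc := inj.ne hjm
  obtain c1 | c1 : InArc i m j ∨ InArc i j m := by
    by_cases c1 : InArc i m j
    · exact .inl c1
    · exact .inr (inArc_of_not_inArc hij him hjm c1)
  · have c2 : InArc (R.src i) (R.src m) (R.src j) := inArc_rotate hab hac hbc (fun hh => E ⟨c1, hh⟩)
    refine three j m i j (by grind) (by grind) (by grind) (by simp) (by simp) (by simp)
      (by simp) (by simp) ?_ ?_ ?_
    · intro c r
      simp only [Equiv.swap_apply_left, Equiv.swap_apply_of_ne_of_ne hij him]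
      rw [arcInd_add c1, arcInd_add c2]
      ring
    · rintro k hk k1 k2
      obtain rfl : k = i := by grind
      exact fun hh => not_inArc_of_inArc ((c1.rotate hjm hij.symm).rotate hij him) hh.1
    · rintro k hk k1 k2
      obtain rfl : k = m := by grind
      simp only [Equiv.swap_apply_left, Equiv.swap_apply_right, Equiv.swap_apply_of_ne_of_ne hij him]
      exact fun hh => not_inArc_of_inArc c1 hh.1
  · have c2 : InArc (R.src i) (R.src m) (R.src j) := inArc_of_not_inArc hac hab hbc.symm (fun hh => E' ⟨c1, hh⟩)
    refine three i m m j (by grind) (by grind) (by grind) (by simp) (by simp) (by simp)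
      (by simp) (by simp) ?_ ?_ ?_
    · intro c r
      simp only [Equiv.swap_apply_right, Equiv.swap_apply_of_ne_of_ne hij.symm hjm]
      rw [arcInd_add c1, arcInd_add c2]
      ring
    · rintro k hk k1 k2
      obtain rfl : k = j := by grind
      exact fun hh => not_inArc_of_inArc c1 hh.1
    · rintro k hk k1 k2
      obtain rfl : k = i := by grind
      simp only [Equiv.swap_apply_left, Equiv.swap_apply_right, Equiv.swap_apply_of_ne_of_ne hij.symm hjm]
      exact fun hh => not_inArc_of_inArc ((c1.rotate hjm.symm him.symm).rotate him hij) hh.1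


theorem exists_alternative_right_right (h1 : S.right = R.right) (hm : S.left ≠ R.left) :
    ∃ R' S' : Rect n, R'.tgt = S'.src ∧ R'.src = R.src ∧ S'.tgt = S.tgt ∧
      R'.chain + S'.chain = R.chain + S.chain ∧ (R', S') ≠ (R, S) := by
  have hmi : S.left ≠ R.right := fun e => S.ne (e.trans h1.symm)
  have src := Rect.src_eq_of_tgt_eq h
  have inj := R.src.injective
  have E := S.empty R.left hm.symm (fun e => R.ne (e.trans h1))
  have E' := R.empty S.left hm hmi
  have hij := R.ne
  have sm := Equiv.swap_apply_of_ne_of_ne hm hmi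
  simp only [src, h1, Equiv.swap_apply_left, Equiv.swap_apply_right, sm] at E
  rw [boxChain_eq_zero_iff] at E E'
  have three := exists_alternative_three h S.left
  simp only [h1, Equiv.swap_apply_right, sm] at three
  generalize S.left = m at *
  generalize R.left = i at *
  generalize R.right = j at *
  have him : i ≠ m := hm.symm
  have hjm : j ≠ m := hmi.symm
  have hab := inj.ne hij
  have hac := inj.ne him
  have hbc := inj.ne hjm
  obtain c1 | c1 : InArc m j i ∨ InArc m i j := by
    by_cases c1 : InArc m j i
    · exact .inl c1
    · exact .inr (inArc_of_not_inArc him.symm hjm.symm hij c1)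
  · have c2 : InArc (R.src m) (R.src j) (R.src i) := inArc_of_not_inArc hbc.symm hac.symm hab.symm (fun hh => E ⟨c1, hh⟩)
    refine three m i i j (by grind) (by grind) (by grind) (by simp) (by simp) (by simp)
      (by simp) (by simp) ?_ ?_ ?_
    · intro c r
      simp only [Equiv.swap_apply_right, Equiv.swap_apply_of_ne_of_ne hjm hij.symm]
      rw [arcInd_add c1, arcInd_add c2]
      ring
    · rintro k hk k1 k2
      obtain rfl : k = j := by grind
      exact fun hh => not_inArc_of_inArc c1 hh.1
    · rintro k hk k1 k2
      obtain rfl : k = m := by grind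
      simp only [Equiv.swap_apply_left, Equiv.swap_apply_right, Equiv.swap_apply_of_ne_of_ne hjm hij.symm]
      exact fun hh => not_inArc_of_inArc ((c1.rotate hij him).rotate him.symm hjm.symm) hh.1
  · have c2 : InArc (R.src m) (R.src j) (R.src i) := inArc_rotate hac.symm hbc.symm hab (fun hh => E' ⟨c1.rotate hij.symm hjm, hh⟩)
    refine three m j i m (by grind) (by grind) (by grind) (by simp) (by simp) (by simp)
      (by simp) (by simp) ?_ ?_ ?_
    · intro c r
      simp only [Equiv.swap_apply_left, Equiv.swap_apply_of_ne_of_ne him hij]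
      rw [arcInd_add (c1.rotate hij.symm hjm), arcInd_add c2]
      ring
    · rintro k hk k1 k2
      obtain rfl : k = i := by grind
      exact fun hh => not_inArc_of_inArc c1 hh.1
    · rintro k hk k1 k2
      obtain rfl : k = j := by grind
      simp only [Equiv.swap_apply_left, Equiv.swap_apply_right, Equiv.swap_apply_of_ne_of_ne him hij]
      exact fun hh => not_inArc_of_inArc (c1.rotate hij.symm hjm) hh.1


/-- Now `S` is to the right of `R` with the bottom sides aligned, so the case distinction is on
which rectangle is taller, and emptiness orders the columns. -/
theorem exists_alternative_left_right (h1 : S.left = R.right) (hm : S.right ≠ R.left) :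
    ∃ R' S' : Rect n, R'.tgt = S'.src ∧ R'.src = R.src ∧ S'.tgt = S.tgt ∧
      R'.chain + S'.chain = R.chain + S.chain ∧ (R', S') ≠ (R, S) := by
  have hmi : S.right ≠ R.right := fun e => S.ne (h1.trans e.symm)
  have src := Rect.src_eq_of_tgt_eq h
  have inj := R.src.injective
  have E := S.empty R.left (fun e => R.ne (e.trans h1)) hm.symm
  have E' := R.empty S.right hm hmi
  have hij := R.ne
  have sm := Equiv.swap_apply_of_ne_of_ne hm hmi
  simp only [src, h1, Equiv.swap_apply_left, Equiv.swap_apply_right, sm] at E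
  rw [boxChain_eq_zero_iff] at E E'
  have three := exists_alternative_three h S.right
  simp only [h1, Equiv.swap_apply_right, sm] at three
  generalize S.right = m at *
  generalize R.left = i at *
  generalize R.right = j at *
  have him : i ≠ m := hm.symm
  have hjm : j ≠ m := hmi.symm
  have hab := inj.ne hij
  have hac := inj.ne him
  have hbc := inj.ne hjm
  obtain c1 | c1 : InArc (R.src i) (R.src m) (R.src j) ∨ InArc (R.src i) (R.src j) (R.src m) := by
    by_cases c1 : InArc (R.src i) (R.src m) (R.src j)
    · exact .inl c1
    · exact .inr (inArc_of_not_inArc hab hac hbc c1)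
  · have c2 : InArc i m j := inArc_rotate hij him hjm (fun hh => E ⟨hh, c1⟩)
    refine three j m i m (by grind) (by grind) (by grind) (by simp) (by simp) (by simp)
      (by simp) (by simp) ?_ ?_ ?_
    · intro c r
      simp only [Equiv.swap_apply_right, Equiv.swap_apply_of_ne_of_ne hij him]
      rw [arcInd_add c2, arcInd_add c1]
      ring
    · rintro k hk k1 k2
      obtain rfl : k = i := by grind
      exact fun hh => not_inArc_of_inArc ((c2.rotate hjm hij.symm).rotate hij him) hh.1
    · rintro k hk k1 k2
      obtain rfl : k = j := by grind
      simp only [Equiv.swap_apply_left, Equiv.swap_apply_right, Equiv.swap_apply_of_ne_of_ne hij him]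
      exact fun hh => not_inArc_of_inArc c1 hh.2
  · have c2 : InArc i m j := inArc_of_not_inArc him hij hjm.symm (fun hh => E' ⟨hh, c1⟩)
    refine three i m i j (by grind) (by grind) (by grind) (by simp) (by simp) (by simp)
      (by simp) (by simp) ?_ ?_ ?_
    · intro c r
      simp only [Equiv.swap_apply_left, Equiv.swap_apply_of_ne_of_ne hij.symm hjm]
      rw [arcInd_add c2, arcInd_add c1]
      ring
    · rintro k hk k1 k2
      obtain rfl : k = j := by grind
      exact fun hh => not_inArc_of_inArc c1 hh.2
    · rintro k hk k1 k2
      obtain rfl : k = m := by grind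
      simp only [Equiv.swap_apply_left, Equiv.swap_apply_right, Equiv.swap_apply_of_ne_of_ne hij.symm hjm]
      exact fun hh => not_inArc_of_inArc c2 hh.1


theorem exists_alternative_right_left (h1 : S.right = R.left) (hm : S.left ≠ R.right) :
    ∃ R' S' : Rect n, R'.tgt = S'.src ∧ R'.src = R.src ∧ S'.tgt = S.tgt ∧
      R'.chain + S'.chain = R.chain + S.chain ∧ (R', S') ≠ (R, S) := by
  have hmi : S.left ≠ R.left := fun e => S.ne (e.trans h1.symm)
  have src := Rect.src_eq_of_tgt_eq h
  have inj := R.src.injective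
  have E := S.empty R.right hm.symm (fun e => R.ne (h1.symm.trans e.symm))
  have E' := R.empty S.left hmi hm
  have hij := R.ne
  have sm := Equiv.swap_apply_of_ne_of_ne hmi hm
  simp only [src, h1, Equiv.swap_apply_left, Equiv.swap_apply_right, sm] at E
  rw [boxChain_eq_zero_iff] at E E'
  have three := exists_alternative_three h S.left
  simp only [h1, Equiv.swap_apply_left, sm] at three
  generalize S.left = m at *
  generalize R.left = i at *
  generalize R.right = j at *
  have him : i ≠ m := hmi.symm
  have hjm : j ≠ m := hm.symm
  have hab := inj.ne hij
  have hac := inj.ne him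
  have hbc := inj.ne hjm
  obtain c1 | c1 : InArc (R.src m) (R.src j) (R.src i) ∨ InArc (R.src m) (R.src i) (R.src j) := by
    by_cases c1 : InArc (R.src m) (R.src j) (R.src i)
    · exact .inl c1
    · exact .inr (inArc_of_not_inArc hac.symm hbc.symm hab c1)
  · have c2 : InArc m j i := inArc_of_not_inArc hjm.symm him.symm hij.symm (fun hh => E ⟨hh, c1⟩)
    refine three m i m j (by grind) (by grind) (by grind) (by simp) (by simp) (by simp)
      (by simp) (by simp) ?_ ?_ ?_
    · intro c r
      simp only [Equiv.swap_apply_left, Equiv.swap_apply_of_ne_of_ne hjm hij.symm]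
      rw [arcInd_add c2, arcInd_add c1]
      ring
    · rintro k hk k1 k2
      obtain rfl : k = j := by grind
      exact fun hh => not_inArc_of_inArc c2 hh.1
    · rintro k hk k1 k2
      obtain rfl : k = i := by grind
      simp only [Equiv.swap_apply_left, Equiv.swap_apply_right, Equiv.swap_apply_of_ne_of_ne hjm hij.symm]
      exact fun hh => not_inArc_of_inArc ((c1.rotate hab hac).rotate hac.symm hbc.symm) hh.2
  · have c2 : InArc m j i := inArc_rotate him.symm hjm.symm hij (fun hh => E' ⟨hh, c1.rotate hab.symm hbc⟩)
    refine three m j i j (by grind) (by grind) (by grind) (by simp) (by simp) (by simp)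
      (by simp) (by simp) ?_ ?_ ?_
    · intro c r
      simp only [Equiv.swap_apply_right, Equiv.swap_apply_of_ne_of_ne him hij]
      rw [arcInd_add c2, arcInd_add (c1.rotate hab.symm hbc)]
      ring
    · rintro k hk k1 k2
      obtain rfl : k = i := by grind
      exact fun hh => not_inArc_of_inArc c1 hh.2
    · rintro k hk k1 k2
      obtain rfl : k = m := by grind
      simp only [Equiv.swap_apply_left, Equiv.swap_apply_right, Equiv.swap_apply_of_ne_of_ne him hij]
      exact fun hh => not_inArc_of_inArc ((c2.rotate hij him).rotate him.symm hjm.symm) hh.1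


end

omit [NeZero n] in
theorem inArc_or {i j : Fin n} (h : i ≠ j) (k : Fin n) : InArc i j k ∨ InArc j i k := by
  have := Fin.val_ne_of_ne h
  rw [inArc_iff, inArc_iff]
  omega

/-- A composite of two rectangles which is not an annulus has a second decomposition. -/
theorem exists_alternative {R S : Rect n} (h : R.tgt = S.src)
    (hh : ¬ IsHorizontalAnnulus (R.chain + S.chain))
    (hv : ¬ IsVerticalAnnulus (R.chain + S.chain)) :
    ∃ R' S' : Rect n, R'.tgt = S'.src ∧ R'.src = R.src ∧ S'.tgt = S.tgt ∧
      R'.chain + S'.chain = R.chain + S.chain ∧ (R', S') ≠ (R, S) := by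
  have src := Rect.src_eq_of_tgt_eq h
  by_cases h1 : S.left = R.left
  · by_cases h2 : S.right = R.right
    · refine absurd ⟨R.left, fun c r => ?_⟩ hv
      rw [Pi.add_apply, Pi.add_apply, Rect.chain, Rect.chain, src, src, h1, h2,
        Equiv.swap_apply_left, Equiv.swap_apply_right, boxChain_eq_arcInd, boxChain_eq_arcInd,
        ← mul_add, arcInd_compl (R.src.injective.ne R.ne), mul_one, arcInd]
      refine if_congr ⟨fun hc => ?_, by rintro rfl; exact inArc_left R.ne⟩ rfl rfl
      -- Any further column of the annulus would carry a point of the state. The row arcs of `R` and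
      -- `S` are complementary, so this point would lie in one of the two rectangles.
      by_contra hne
      have hne' : c ≠ R.right := fun e => not_inArc_right _ _ (e ▸ hc)
      have e1 := R.empty c hne hne'
      have e2 := S.empty c (h1 ▸ hne) (h2 ▸ hne')
      rw [src, src, src, h1, h2, Equiv.swap_apply_left, Equiv.swap_apply_right,
        Equiv.swap_apply_of_ne_of_ne hne hne'] at e2
      rw [boxChain_eq_zero_iff] at e1 e2
      rcases inArc_or (R.src.injective.ne R.ne) (R.src c) with hr | hr
      · exact e1 ⟨hc, hr⟩
      · exact e2 ⟨hc, hr⟩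
    · exact exists_alternative_left_left h h1 h2
  · by_cases h2 : S.left = R.right
    · by_cases h3 : S.right = R.left
      · refine absurd ⟨R.src R.left, fun c r => ?_⟩ hh
        rw [Pi.add_apply, Pi.add_apply, Rect.chain, Rect.chain, src, src, h2, h3,
          Equiv.swap_apply_left, Equiv.swap_apply_right, boxChain_eq_arcInd, boxChain_eq_arcInd,
          ← add_mul, arcInd_compl R.ne, one_mul, arcInd]
        refine if_congr ⟨fun hc => ?_, by
          rintro rfl; exact inArc_left (R.src.injective.ne R.ne)⟩ rfl rfl
        by_contra hne
        obtain ⟨k, rfl⟩ := R.src.surjective r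
        have hk : k ≠ R.left := fun e => hne (e ▸ rfl)
        have hk' : k ≠ R.right := fun e => not_inArc_right _ _ (e ▸ hc)
        have e1 := R.empty k hk hk'
        have e2 := S.empty k (h2 ▸ hk') (h3 ▸ hk)
        rw [src, src, src, h2, h3, Equiv.swap_apply_left, Equiv.swap_apply_right,
          Equiv.swap_apply_of_ne_of_ne hk hk'] at e2
        rw [boxChain_eq_zero_iff] at e1 e2
        rcases inArc_or R.ne k with hr | hr
        · exact e1 ⟨hr, hc⟩
        · exact e2 ⟨hr, hc⟩
      · exact exists_alternative_left_right h h2 h3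
    · by_cases h3 : S.right = R.left
      · exact exists_alternative_right_left h h3 h2
      · by_cases h4 : S.right = R.right
        · exact exists_alternative_right_right h h4 h1
        · exact exists_alternative_disjoint h h1 h2 h3 h4

/-! ### Annuli and rectangles of width or height one -/

/-- The 2-chain of the `i`-th row. -/
def rowChain (i : Fin n) : Chain n := fun _ r => if r = i then 1 else 0

/-- The 2-chain of the `i`-th column. -/
def columnChain (i : Fin n) : Chain n := fun c _ => if c = i then 1 else 0

/-- The arc contains its starting point `i`, and by `arc_diff` it also contains `i + 1` unless it
ends there. This makes the decomposition of an annulus unique. -/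
theorem inArc_iff_eq {i j r : Fin n} (hij : i ≠ j) (h : ∀ k, InArc i j k → k = r) :
    i = r ∧ j = r + 1 := by
  have hi := h i (inArc_left hij)
  refine ⟨hi, ?_⟩
  by_contra hj
  subst hi
  have hn : i + 1 = i → n = 1 := by
    intro e
    have h1 : (1 : Fin n) = 0 := by simpa using e
    have h2 := congrArg Fin.val h1
    rw [Fin.val_one', Fin.val_zero] at h2
    by_contra hn
    have := Nat.pos_of_ne_zero (NeZero.ne n)
    rw [Nat.mod_eq_of_lt (by omega)] at h2
    omega
  have := arc_diff hij (i + 1)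
  rw [add_sub_cancel_right, if_pos (inArc_left hij), if_neg (Ne.symm hj)] at this
  by_cases e : i + 1 = i
  · have := i.isLt
    have := j.isLt
    exact hij (Fin.ext (by have := hn e; omega))
  · rw [if_neg e] at this
    have h2 := mt (h (i + 1)) e
    rw [if_neg h2] at this
    norm_num at this

theorem inArc_succ {i : Fin n} (h : i ≠ i + 1) (k : Fin n) : InArc i (i + 1) k ↔ k = i := by
  have hn : ∀ j, i ≠ j → 1 < n := by
    intro j hj
    have := i.isLt
    have := j.isLt
    have := Fin.val_ne_of_ne hj
    omega
  have h1 : ((i + 1 - i : Fin n)).val = 1 := by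
    rw [add_sub_cancel_left, Fin.val_one']
    exact Nat.mod_eq_of_lt (hn _ h)
  rw [InArc, h1, Nat.lt_one_iff, ← sub_eq_zero (a := k), Fin.ext_iff, Fin.val_zero]

theorem Rect.of_chain_le_row {R : Rect n} {i : Fin n}
    (h : ∀ c r, R.chain c r ≤ rowChain i c r) : R.src R.left = i ∧ R.src R.right = i + 1 := by
  refine inArc_iff_eq (R.src.injective.ne R.ne) fun k hk => ?_
  have := h R.left k
  by_contra hne
  rw [Rect.chain, boxChain, if_pos ⟨inArc_left R.ne, hk⟩, rowChain, if_neg hne] at this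
  norm_num at this

theorem Rect.of_chain_le_column {R : Rect n} {i : Fin n}
    (h : ∀ c r, R.chain c r ≤ columnChain i c r) : R.left = i ∧ R.right = i + 1 := by
  refine inArc_iff_eq R.ne fun k hk => ?_
  have := h k (R.src R.left)
  by_contra hne
  rw [Rect.chain, boxChain, if_pos ⟨hk, inArc_left (R.src.injective.ne R.ne)⟩, columnChain,
    if_neg hne] at this
  norm_num at this

theorem add_one_ne_self {i : Fin n} (h : i ≠ last n) : i ≠ i + 1 := by
  intro e
  have h1 : (1 : Fin n) = 0 := by simpa using e.symm
  have h2 := congrArg Fin.val h1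
  rw [Fin.val_one', Fin.val_zero] at h2
  refine h (Fin.ext ?_)
  have := i.isLt
  by_contra
  rw [Nat.mod_eq_of_lt (by omega)] at h2
  omega

/-- The rectangle of height one in row `i` starting at the state `x`. -/
def rowRect (x : State n) (i : Fin n) (hi : i ≠ last n) : Rect n where
  src := x
  left := x.symm i
  right := x.symm (i + 1)
  ne := x.symm.injective.ne (add_one_ne_self hi)
  empty := fun k h1 _ => by
    rw [boxChain_eq_zero_iff, x.apply_symm_apply, x.apply_symm_apply,
      inArc_succ (add_one_ne_self hi)]
    rintro ⟨_, rfl⟩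
    simp at h1
  avoid := by
    rw [boxChain_eq_zero_iff, x.apply_symm_apply, x.apply_symm_apply,
      inArc_succ (add_one_ne_self hi)]
    exact fun h => hi h.2.symm

/-- The rectangle of width one in column `i` starting at the state `x`. -/
def columnRect (x : State n) (i : Fin n) (hi : i ≠ last n) : Rect n where
  src := x
  left := i
  right := i + 1
  ne := add_one_ne_self hi
  empty := fun k h1 _ => by
    rw [boxChain_eq_zero_iff, inArc_succ (add_one_ne_self hi)]
    exact fun h => h1 h.1
  avoid := by
    rw [boxChain_eq_zero_iff, inArc_succ (add_one_ne_self hi)]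
    exact fun h => hi h.1.symm

theorem rowRect_chain (x : State n) (i : Fin n) (hi : i ≠ last n) (c r : Fin n) :
    (rowRect x i hi).chain c r = if r = i then arcInd (x.symm i) (x.symm (i + 1)) c else 0 := by
  change boxChain (x.symm i) (x.symm (i + 1)) (x (x.symm i)) (x (x.symm (i + 1))) c r = _
  rw [boxChain_eq_arcInd, x.apply_symm_apply, x.apply_symm_apply, arcInd, arcInd,
    if_congr (inArc_succ (add_one_ne_self hi) r) rfl rfl, mul_ite, mul_one, mul_zero]

theorem columnRect_chain (x : State n) (i : Fin n) (hi : i ≠ last n) (c r : Fin n) :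
    (columnRect x i hi).chain c r = if c = i then arcInd (x i) (x (i + 1)) r else 0 := by
  change boxChain i (i + 1) (x i) (x (i + 1)) c r = _
  rw [boxChain_eq_arcInd, arcInd, if_congr (inArc_succ (add_one_ne_self hi) c) rfl rfl, ite_mul,
    one_mul, zero_mul]

theorem rowRect_tgt_symm (x : State n) (i : Fin n) (hi : i ≠ last n) :
    (rowRect x i hi).tgt.symm i = x.symm (i + 1) ∧
      (rowRect x i hi).tgt.symm (i + 1) = x.symm i := by
  constructor <;> rw [Equiv.symm_apply_eq] <;> simp [Rect.tgt, rowRect]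

theorem columnRect_tgt (x : State n) (i : Fin n) (hi : i ≠ last n) :
    (columnRect x i hi).tgt i = x (i + 1) ∧ (columnRect x i hi).tgt (i + 1) = x i := by
  constructor <;> simp [Rect.tgt, columnRect]

theorem rowRect_add (x : State n) (i : Fin n) (hi : i ≠ last n) :
    (rowRect x i hi).chain + (rowRect (rowRect x i hi).tgt i hi).chain = rowChain i := by
  funext c r
  rw [Pi.add_apply, Pi.add_apply, rowRect_chain, rowRect_chain, (rowRect_tgt_symm x i hi).1,
    (rowRect_tgt_symm x i hi).2, rowChain]
  split_ifs
  · exact arcInd_compl (x.symm.injective.ne (add_one_ne_self hi)) c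
  · rfl

theorem columnRect_add (x : State n) (i : Fin n) (hi : i ≠ last n) :
    (columnRect x i hi).chain + (columnRect (columnRect x i hi).tgt i hi).chain =
      columnChain i := by
  funext c r
  rw [Pi.add_apply, Pi.add_apply, columnRect_chain, columnRect_chain, (columnRect_tgt x i hi).1,
    (columnRect_tgt x i hi).2, columnChain]
  split_ifs
  · exact arcInd_compl (x.injective.ne (add_one_ne_self hi)) r
  · rfl

theorem Rect.eq_rowRect {R : Rect n} {i : Fin n} (hi : i ≠ last n)
    (h : ∀ c r, R.chain c r ≤ rowChain i c r) : R = rowRect R.src i hi := by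
  obtain ⟨h1, h2⟩ := Rect.of_chain_le_row h
  refine Rect.ext rfl ?_ ?_
  · change R.left = R.src.symm i
    rw [← h1, R.src.symm_apply_apply]
  · change R.right = R.src.symm (i + 1)
    rw [← h2, R.src.symm_apply_apply]

theorem Rect.eq_columnRect {R : Rect n} {i : Fin n} (hi : i ≠ last n)
    (h : ∀ c r, R.chain c r ≤ columnChain i c r) : R = columnRect R.src i hi := by
  obtain ⟨h1, h2⟩ := Rect.of_chain_le_column h
  exact Rect.ext rfl h1 h2

theorem Rect.chain_le_of_add_eq {R S : Rect n} {C : Chain n} (h : R.chain + S.chain = C) :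
    (∀ c r, R.chain c r ≤ C c r) ∧ ∀ c r, S.chain c r ≤ C c r := by
  subst h
  exact ⟨fun c r => le_add_of_nonneg_right (S.chain_nonneg c r),
    fun c r => le_add_of_nonneg_left (R.chain_nonneg c r)⟩

theorem Rect.add_last_last (R S : Rect n) : (R.chain + S.chain) (last n) (last n) = 0 := by
  rw [Pi.add_apply, Pi.add_apply, show R.chain (last n) (last n) = 0 from R.avoid,
    show S.chain (last n) (last n) = 0 from S.avoid, add_zero]

theorem isDomain_row (x : State n) (i : Fin n) : IsDomain x x (rowChain i) := by
  intro c r; simp [cornerBoundary, rowChain]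

theorem isDomain_column (x : State n) (i : Fin n) : IsDomain x x (columnChain i) := by
  intro c r; simp [cornerBoundary, columnChain]


/-! ### The differential on chains extended by zero -/

open Classical in
/-- The basis element of `CD_k` with the given ends and 2-chain, and `0` if there is none. -/
noncomputable def domainChain (k : ℕ) (x y : State n) (C : Chain n) : CD n k :=
  if h : ∃ D : Basis n k, D.1.src = x ∧ D.1.tgt = y ∧ D.1.chain = C then
    Finsupp.single h.choose 1 else 0

theorem domainChain_basis {k : ℕ} (D : Basis n k) :
    domainChain k D.1.src D.1.tgt D.1.chain = Finsupp.single D 1 := by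
  have h : ∃ E : Basis n k, E.1.src = D.1.src ∧ E.1.tgt = D.1.tgt ∧ E.1.chain = D.1.chain :=
    ⟨D, rfl, rfl, rfl⟩
  rw [domainChain, dif_pos h]
  obtain ⟨h1, h2, h3⟩ := h.choose_spec
  rw [show h.choose = D from Subtype.ext (PosDomain.ext h1 h2 h3)]

theorem domainChain_eq_zero {k : ℕ} {x y : State n} {C : Chain n}
    (h : ¬ ∃ D : Basis n k, D.1.src = x ∧ D.1.tgt = y ∧ D.1.chain = C) :
    domainChain k x y C = 0 := dif_neg h

theorem delta_single (s : SignAssignment n) (k : ℕ) (D : Basis n (k + 1)) :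
    delta s k (Finsupp.single D 1) = deltaBasis s k D := by
  rw [delta, Finsupp.linearCombination_single, one_smul]

/-- Prepending a rectangle to a domain. -/
def PosDomain.prepend (R : Rect n) (E : PosDomain n) (h : R.tgt = E.src) : PosDomain n where
  src := R.src
  tgt := E.tgt
  chain := fun c r => E.chain c r + R.chain c r
  isDomain := by
    have := R.isDomain.add (h ▸ E.isDomain)
    rwa [add_comm] at this
  nonneg := fun c r => add_nonneg (E.nonneg c r) (R.chain_nonneg c r)
  avoid := by rw [E.avoid, show R.chain (last n) (last n) = 0 from R.avoid, add_zero]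

/-- Appending a rectangle to a domain. -/
def PosDomain.append (E : PosDomain n) (R : Rect n) (h : E.tgt = R.src) : PosDomain n where
  src := E.src
  tgt := R.tgt
  chain := fun c r => E.chain c r + R.chain c r
  isDomain := E.isDomain.add (h ▸ R.isDomain)
  nonneg := fun c r => add_nonneg (E.nonneg c r) (R.chain_nonneg c r)
  avoid := by rw [E.avoid, show R.chain (last n) (last n) = 0 from R.avoid, add_zero]

theorem PosDomain.maslov_prepend (R : Rect n) (E : PosDomain n) (h : R.tgt = E.src) :
    (E.prepend R h).maslov = E.maslov + 1 := by
  rw [add_comm, ← R.maslov_eq_one]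
  exact PosDomain.maslov_add rfl h rfl fun c r => add_comm _ _

theorem PosDomain.maslov_append (R : Rect n) (E : PosDomain n) (h : E.tgt = R.src) :
    (E.append R h).maslov = E.maslov + 1 := by
  rw [← R.maslov_eq_one]
  exact PosDomain.maslov_add rfl h rfl fun c r => rfl

/-- Prepending a rectangle to a basis element. -/
def Basis.prepend {k : ℕ} (R : Rect n) (E : Basis n k) (h : R.tgt = E.1.src) : Basis n (k + 1) :=
  ⟨E.1.prepend R h, by rw [PosDomain.maslov_prepend, E.2]; push_cast; rfl⟩

/-- Appending a rectangle to a basis element. -/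
def Basis.append {k : ℕ} (E : Basis n k) (R : Rect n) (h : E.1.tgt = R.src) : Basis n (k + 1) :=
  ⟨E.1.append R h, by rw [PosDomain.maslov_append, E.2]; push_cast; rfl⟩

open Classical in
-- As `domainChain` is zero when there is no such domain, the containment conditions on `R` can be
-- dropped and the formula holds for every chain `C`: a nonzero term forces `R` to be contained in
-- `C`, and a domain `C - R` with the right ends makes `C` a domain. This allows `δ` to be iterated
-- without carrying proofs of containment.
theorem delta_domainChain (s : SignAssignment n) (k : ℕ) (x y : State n) (C : Chain n) :
    delta s k (domainChain (k + 1) x y C) =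
      (∑ R : Rect n, if R.src = x then
        ((s.sign R : ℤˣ) : ℤ) • domainChain k R.tgt y (C - R.chain) else 0) +
      (-1 : ℤ) ^ (k + 1) • ∑ R : Rect n, if R.tgt = y then
        ((s.sign R : ℤˣ) : ℤ) • domainChain k x R.src (C - R.chain) else 0 := by
  by_cases hC : ∃ D : Basis n (k + 1), D.1.src = x ∧ D.1.tgt = y ∧ D.1.chain = C
  · obtain ⟨D, rfl, rfl, rfl⟩ := hC
    rw [domainChain_basis, delta_single, deltaBasis]
    have hle : ∀ (R : Rect n) (u v : State n), domainChain k u v (D.1.chain - R.chain) ≠ 0 →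
        ∀ c r, R.chain c r ≤ D.1.chain c r := by
      intro R u v hne c r
      by_contra hlt
      refine hne (domainChain_eq_zero ?_)
      rintro ⟨E, -, -, hE⟩
      have := E.1.nonneg c r
      rw [hE, Pi.sub_apply, Pi.sub_apply] at this
      linarith
    congr 1
    · refine Finset.sum_congr rfl fun R _ => ?_
      by_cases h : R.IsInitial D.1
      · rw [dif_pos h, if_pos h.1]
        have := domainChain_basis (D.removeInitial R h)
        rw [show domainChain k R.tgt D.1.tgt (D.1.chain - R.chain) = _ from this,
          Finsupp.smul_single, smul_eq_mul, mul_one]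
      · rw [dif_neg h]
        split_ifs with h1
        · by_cases h0 : domainChain k R.tgt D.1.tgt (D.1.chain - R.chain) = 0
          · rw [h0, smul_zero]
          · exact absurd ⟨h1, hle R _ _ h0⟩ h
        · rfl
    · congr 1
      refine Finset.sum_congr rfl fun R _ => ?_
      by_cases h : R.IsFinal D.1
      · rw [dif_pos h, if_pos h.1]
        have := domainChain_basis (D.removeFinal R h)
        rw [show domainChain k D.1.src R.src (D.1.chain - R.chain) = _ from this,
          Finsupp.smul_single, smul_eq_mul, mul_one]
      · rw [dif_neg h]
        split_ifs with h1
        · by_cases h0 : domainChain k D.1.src R.src (D.1.chain - R.chain) = 0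
          · rw [h0, smul_zero]
          · exact absurd ⟨h1, hle R _ _ h0⟩ h
        · rfl
  · rw [domainChain_eq_zero hC, map_zero, Finset.sum_eq_zero, Finset.sum_eq_zero, smul_zero,
      add_zero]
    · intro R _
      split_ifs with h
      · rw [domainChain_eq_zero, smul_zero]
        rintro ⟨E, h1, h2, h3⟩
        refine hC ⟨E.append R h2, h1, h, ?_⟩
        change E.1.chain + R.chain = C
        rw [h3, sub_add_cancel]
      · rfl
    · intro R _
      split_ifs with h
      · rw [domainChain_eq_zero, smul_zero]
        rintro ⟨E, h1, h2, h3⟩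
        refine hC ⟨E.prepend R h1.symm, h, h2, ?_⟩
        change E.1.chain + R.chain = C
        rw [h3, sub_add_cancel]
      · rfl

/-! ### Sums over composable pairs and `δ² = 0` -/

open Classical in
/-- The pairs of composable rectangles. -/
noncomputable def composablePairs (n : ℕ) [NeZero n] : Finset (Rect n × Rect n) :=
  Finset.univ.filter fun p => p.1.tgt = p.2.src

/-- The product of the signs of two rectangles. -/
def SignAssignment.pairSign (s : SignAssignment n) (p : Rect n × Rect n) : ℤ :=
  ((s.sign p.1 * s.sign p.2 : ℤˣ) : ℤ)

section
variable {M : Type*} [AddCommGroup M]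

theorem units_ne_neg (u : ℤˣ) : u ≠ -u := by
  rcases Int.units_eq_one_or u with rfl | rfl <;> decide

open Classical in
/-- The contributions of the two decompositions of a composite that is not an annulus cancel. -/
theorem sum_not_annulus (s : SignAssignment n) (F : State n → State n → Chain n → M) :
    ∑ p ∈ (composablePairs n).filter (fun p => ¬ IsHorizontalAnnulus (p.1.chain + p.2.chain) ∧
      ¬ IsVerticalAnnulus (p.1.chain + p.2.chain)),
      s.pairSign p • F p.1.src p.2.tgt (p.1.chain + p.2.chain) = 0 := by
  have key : ∀ p ∈ (composablePairs n).filter (fun p =>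
      ¬ IsHorizontalAnnulus (p.1.chain + p.2.chain) ∧
        ¬ IsVerticalAnnulus (p.1.chain + p.2.chain)), ∃ q : Rect n × Rect n,
      q ∈ (composablePairs n).filter (fun p =>
      ¬ IsHorizontalAnnulus (p.1.chain + p.2.chain) ∧
        ¬ IsVerticalAnnulus (p.1.chain + p.2.chain)) ∧
      q.1.src = p.1.src ∧ q.2.tgt = p.2.tgt ∧ q.1.chain + q.2.chain = p.1.chain + p.2.chain ∧
      q ≠ p := by
    rintro ⟨R, S⟩ hp
    simp only [composablePairs, Finset.mem_filter, Finset.mem_univ, true_and] at hp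
    obtain ⟨R', S', h1, h2, h3, h4, h5⟩ := exists_alternative hp.1 hp.2.1 hp.2.2
    refine ⟨(R', S'), ?_, h2, h3, h4, h5⟩
    simp only [composablePairs, Finset.mem_filter, Finset.mem_univ, true_and]
    rw [h4]
    exact ⟨h1, hp.2⟩
  choose g hg1 hg2 hg3 hg4 hg5 using key
  have anti : ∀ p q : Rect n × Rect n, p ∈ (composablePairs n).filter (fun p =>
      ¬ IsHorizontalAnnulus (p.1.chain + p.2.chain) ∧
        ¬ IsVerticalAnnulus (p.1.chain + p.2.chain)) → q ∈ composablePairs n →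
      q.1.src = p.1.src → q.2.tgt = p.2.tgt → q.1.chain + q.2.chain = p.1.chain + p.2.chain →
      q ≠ p → s.sign p.1 * s.sign p.2 = -(s.sign q.1 * s.sign q.2) := by
    intro p q hp hq h1 h2 h3 h4
    simp only [composablePairs, Finset.mem_filter, Finset.mem_univ, true_and] at hp hq
    exact s.anticomm p.1 p.2 q.1 q.2 hp.1 hq h1.symm h2.symm h3.symm hp.2.1 hp.2.2
      (fun e => h4 e.symm)
  -- The alternative `g` is an arbitrary choice. It is nevertheless an involution: three distinct
  -- decompositions of one composite would have pairwise opposite signs, which is impossible in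
  -- `{±1}`.
  refine Finset.sum_involution g ?_ ?_ hg1 ?_
  · intro p hp
    rw [hg2, hg3, hg4, ← add_smul, SignAssignment.pairSign, SignAssignment.pairSign,
      anti p (g p hp) hp (Finset.mem_filter.1 (hg1 p hp)).1 (hg2 p hp) (hg3 p hp) (hg4 p hp)
      (hg5 p hp)]
    simp
  · intro p hp _
    exact hg5 p hp
  · intro p hp
    by_contra hne
    have a1 := anti p (g p hp) hp (Finset.mem_filter.1 (hg1 p hp)).1 (hg2 p hp) (hg3 p hp)
      (hg4 p hp) (hg5 p hp)
    have hp2 := hg1 p hp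
    have a2 := anti (g p hp) (g _ hp2) hp2 (Finset.mem_filter.1 (hg1 _ hp2)).1 (hg2 _ hp2)
      (hg3 _ hp2) (hg4 _ hp2) (hg5 _ hp2)
    have a3 := anti p (g _ hp2) hp (Finset.mem_filter.1 (hg1 _ hp2)).1
      ((hg2 _ hp2).trans (hg2 p hp)) ((hg3 _ hp2).trans (hg3 p hp))
      ((hg4 _ hp2).trans (hg4 p hp)) hne
    rw [a3] at a1
    exact units_ne_neg _ (a2.trans (congrArg Neg.neg (neg_inj.1 a1)))

open Classical in
-- A decomposition of a row consists of two rectangles of height one, and the initial state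
-- determines both; the last row is excluded by the marking.
theorem sum_horizontal (s : SignAssignment n) (F : State n → State n → Chain n → M) :
    ∑ p ∈ (composablePairs n).filter (fun p => IsHorizontalAnnulus (p.1.chain + p.2.chain)),
      s.pairSign p • F p.1.src p.2.tgt (p.1.chain + p.2.chain) =
    ∑ q : State n × {i : Fin n // i ≠ last n}, F q.1 q.1 (rowChain q.2.1) := by
  symm
  refine Finset.sum_bij (fun q _ => (rowRect q.1 q.2.1 q.2.2,
    rowRect (rowRect q.1 q.2.1 q.2.2).tgt q.2.1 q.2.2)) ?_ ?_ ?_ ?_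
  · rintro ⟨x, i, hi⟩ _
    simp only [composablePairs, Finset.mem_filter, Finset.mem_univ, true_and]
    rw [rowRect_add]
    exact ⟨rfl, i, fun _ _ => rfl⟩
  · rintro ⟨x, i, hi⟩ _ ⟨y, j, hj⟩ _ e
    have h1 : rowRect x i hi = rowRect y j hj := congrArg Prod.fst e
    have h2 : x = y := congrArg Rect.src h1
    subst h2
    have h3 : x.symm i = x.symm j := congrArg Rect.left h1
    have h4 := x.symm.injective h3
    subst h4
    rfl
  · rintro ⟨R, S⟩ hp
    simp only [composablePairs, Finset.mem_filter, Finset.mem_univ, true_and] at hp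
    obtain ⟨h, i, hi⟩ := hp
    have hi' : R.chain + S.chain = rowChain i := funext fun c => funext fun r => hi c r
    have hl : i ≠ last n := by
      rintro rfl
      have := Rect.add_last_last R S
      rw [hi'] at this
      simp [rowChain] at this
    obtain ⟨h1, h2⟩ := Rect.chain_le_of_add_eq hi'
    refine ⟨(R.src, ⟨i, hl⟩), Finset.mem_univ _, ?_⟩
    have e1 := Rect.eq_rowRect hl h1
    have e2 := Rect.eq_rowRect hl h2
    rw [← h] at e2
    change (rowRect R.src i hl, rowRect (rowRect R.src i hl).tgt i hl) = (R, S)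
    rw [← e1, ← e2]
  · rintro ⟨x, i, hi⟩ _
    have hc := rowRect_add x i hi
    have hd := Rect.isDomain_add (R := rowRect x i hi) (S := rowRect (rowRect x i hi).tgt i hi) rfl
    have hs := s.horizontal (rowRect x i hi) (rowRect (rowRect x i hi).tgt i hi) rfl
      (by rw [hc]; exact ⟨i, fun _ _ => rfl⟩)
    rw [hc] at hd
    have ht := hd.tgt_unique (isDomain_row x i)
    simp only [SignAssignment.pairSign]
    rw [hs, hc, ht, Units.val_one, one_smul]
    rfl

open Classical in
theorem sum_vertical (s : SignAssignment n) (F : State n → State n → Chain n → M) :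
    ∑ p ∈ (composablePairs n).filter (fun p => IsVerticalAnnulus (p.1.chain + p.2.chain)),
      s.pairSign p • F p.1.src p.2.tgt (p.1.chain + p.2.chain) =
    ∑ q : State n × {i : Fin n // i ≠ last n}, -F q.1 q.1 (columnChain q.2.1) := by
  symm
  refine Finset.sum_bij (fun q _ => (columnRect q.1 q.2.1 q.2.2,
    columnRect (columnRect q.1 q.2.1 q.2.2).tgt q.2.1 q.2.2)) ?_ ?_ ?_ ?_
  · rintro ⟨x, i, hi⟩ _
    simp only [composablePairs, Finset.mem_filter, Finset.mem_univ, true_and]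
    rw [columnRect_add]
    exact ⟨rfl, i, fun _ _ => rfl⟩
  · rintro ⟨x, i, hi⟩ _ ⟨y, j, hj⟩ _ e
    have h1 : columnRect x i hi = columnRect y j hj := congrArg Prod.fst e
    have h2 : x = y := congrArg Rect.src h1
    subst h2
    have h3 : i = j := congrArg Rect.left h1
    subst h3
    rfl
  · rintro ⟨R, S⟩ hp
    simp only [composablePairs, Finset.mem_filter, Finset.mem_univ, true_and] at hp
    obtain ⟨h, i, hi⟩ := hp
    have hi' : R.chain + S.chain = columnChain i := funext fun c => funext fun r => hi c r
    have hl : i ≠ last n := by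
      rintro rfl
      have := Rect.add_last_last R S
      rw [hi'] at this
      simp [columnChain] at this
    obtain ⟨h1, h2⟩ := Rect.chain_le_of_add_eq hi'
    refine ⟨(R.src, ⟨i, hl⟩), Finset.mem_univ _, ?_⟩
    have e1 := Rect.eq_columnRect hl h1
    have e2 := Rect.eq_columnRect hl h2
    rw [← h] at e2
    change (columnRect R.src i hl, columnRect (columnRect R.src i hl).tgt i hl) = (R, S)
    rw [← e1, ← e2]
  · rintro ⟨x, i, hi⟩ _
    have hc := columnRect_add x i hi
    have hd := Rect.isDomain_add (R := columnRect x i hi)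
      (S := columnRect (columnRect x i hi).tgt i hi) rfl
    have hs := s.vertical (columnRect x i hi) (columnRect (columnRect x i hi).tgt i hi) rfl
      (by rw [hc]; exact ⟨i, fun _ _ => rfl⟩)
    rw [hc] at hd
    have ht := hd.tgt_unique (isDomain_column x i)
    simp only [SignAssignment.pairSign]
    rw [hs, hc, ht, Units.val_neg, Units.val_one, neg_smul, one_smul]
    rfl

/-- Summing over all composable pairs of rectangles, only the annuli contribute. -/
theorem sum_composablePairs (s : SignAssignment n) (F : State n → State n → Chain n → M) :
    ∑ p ∈ composablePairs n, s.pairSign p • F p.1.src p.2.tgt (p.1.chain + p.2.chain) =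
    ∑ q : State n × {i : Fin n // i ≠ last n},
      (F q.1 q.1 (rowChain q.2.1) - F q.1 q.1 (columnChain q.2.1)) := by
  classical
  -- A composite that is both kinds of annulus would have sign product both `1` and `-1`.
  have hdisj : ∀ p ∈ composablePairs n, IsVerticalAnnulus (p.1.chain + p.2.chain) →
      ¬ IsHorizontalAnnulus (p.1.chain + p.2.chain) := by
    intro p hp h1 h2
    have hp' : p.1.tgt = p.2.src := (Finset.mem_filter.1 hp).2
    have := (s.vertical p.1 p.2 hp' h1).symm.trans (s.horizontal p.1 p.2 hp' h2)
    exact units_ne_neg 1 this.symm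
  rw [← Finset.sum_filter_add_sum_filter_not _
    (fun p => IsHorizontalAnnulus (p.1.chain + p.2.chain)), sum_horizontal,
    ← Finset.sum_filter_add_sum_filter_not (Finset.filter _ _)
    (fun p => IsVerticalAnnulus (p.1.chain + p.2.chain)), Finset.filter_filter,
    Finset.filter_filter, sum_not_annulus, add_zero]
  rw [Finset.filter_congr (q := fun p => IsVerticalAnnulus (p.1.chain + p.2.chain)),
    sum_vertical, ← Finset.sum_add_distrib]
  · simp only [sub_eq_add_neg]
  · exact fun p hp => ⟨fun h => h.2, fun h => ⟨hdisj p hp h, h⟩⟩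

end

/-- Double removal at either end reduces, by `sum_composablePairs`, to the same sum over rows minus
columns; the signs of `δ` make these two sums, and likewise the two mixed sums, cancel. -/
theorem delta_comp_delta (s : SignAssignment n) (k : ℕ) :
    delta s k ∘ₗ delta s (k + 1) = 0 := by
  classical
  refine Finsupp.lhom_ext' fun D => LinearMap.ext_ring ?_
  simp only [LinearMap.comp_apply, Finsupp.lsingle_apply, LinearMap.zero_apply]
  rw [← domainChain_basis]
  generalize D.1.src = x
  generalize D.1.tgt = y
  generalize D.1.chain = C
  have front : ∑ R : Rect n, (if R.src = x then ((s.sign R : ℤˣ) : ℤ) • ∑ S : Rect n,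
      (if S.src = R.tgt then ((s.sign S : ℤˣ) : ℤ) •
        domainChain k S.tgt y (C - R.chain - S.chain) else 0) else 0) =
      ∑ q : State n × {i : Fin n // i ≠ last n}, if q.1 = x then
        (domainChain k x y (C - rowChain q.2.1) - domainChain k x y (C - columnChain q.2.1))
        else 0 := by
    have := sum_composablePairs s
      (fun a b K => if a = x then domainChain k b y (C - K) else 0)
    rw [composablePairs, Finset.sum_filter, Fintype.sum_prod_type] at this
    refine Eq.trans ?_ (this.trans ?_)
    · refine Finset.sum_congr rfl fun R _ => ?_
      by_cases h : R.src = x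
      · simp only [h, if_true, Finset.smul_sum]
        refine Finset.sum_congr rfl fun S _ => ?_
        simp only [smul_ite, smul_zero, SignAssignment.pairSign, Units.val_mul, mul_smul,
          sub_sub, eq_comm (a := R.tgt)]
      · simp [h]
    · refine Finset.sum_congr rfl fun q _ => ?_
      split_ifs with h
      · rw [h]
      · rw [sub_zero]
  have back : ∑ R : Rect n, (if R.tgt = y then ((s.sign R : ℤˣ) : ℤ) • ∑ S : Rect n,
      (if S.tgt = R.src then ((s.sign S : ℤˣ) : ℤ) •
        domainChain k x S.src (C - R.chain - S.chain) else 0) else 0) =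
      ∑ q : State n × {i : Fin n // i ≠ last n}, if q.1 = y then
        (domainChain k x y (C - rowChain q.2.1) - domainChain k x y (C - columnChain q.2.1))
        else 0 := by
    have := sum_composablePairs s
      (fun a b K => if b = y then domainChain k x a (C - K) else 0)
    rw [composablePairs, Finset.sum_filter, Fintype.sum_prod_type, Finset.sum_comm] at this
    refine Eq.trans ?_ (this.trans ?_)
    · refine Finset.sum_congr rfl fun R _ => ?_
      by_cases h : R.tgt = y
      · simp only [h, if_true, Finset.smul_sum]
        refine Finset.sum_congr rfl fun S _ => ?_
        simp only [smul_ite, smul_zero, SignAssignment.pairSign, Units.val_mul, mul_smul,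
          sub_sub, add_comm R.chain]
        rw [smul_comm]
      · simp [h]
    · refine Finset.sum_congr rfl fun q _ => ?_
      split_ifs with h
      · rw [h]
      · rw [sub_zero]
  -- The same annuli are available at every state, so it does not matter whether they are removed at
  -- `x` or at `y`.
  have annuli : ∀ z w : State n, ∀ G : {i : Fin n // i ≠ last n} → CD n k,
      (∑ q : State n × {i : Fin n // i ≠ last n}, if q.1 = z then G q.2 else 0) =
      ∑ q : State n × {i : Fin n // i ≠ last n}, if q.1 = w then G q.2 else 0 := by
    intro z w G
    simp only [Fintype.sum_prod_type, Finset.sum_ite_irrel, Finset.sum_const_zero,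
      Finset.sum_ite_eq', Finset.mem_univ, if_true]
  have mixed : ∑ R : Rect n, (if R.src = x then ((s.sign R : ℤˣ) : ℤ) • ∑ S : Rect n,
      (if S.tgt = y then ((s.sign S : ℤˣ) : ℤ) •
        domainChain k R.tgt S.src (C - R.chain - S.chain) else 0) else 0) =
      ∑ R : Rect n, (if R.tgt = y then ((s.sign R : ℤˣ) : ℤ) • ∑ S : Rect n,
      (if S.src = x then ((s.sign S : ℤˣ) : ℤ) •
        domainChain k S.tgt R.src (C - R.chain - S.chain) else 0) else 0) := by
    have dist : ∀ (P : Prop) [Decidable P] (a : ℤ) (G : Rect n → CD n k),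
        (if P then a • ∑ S, G S else 0) = ∑ S, if P then a • G S else 0 := by
      intro P _ a G
      split_ifs
      · rw [Finset.smul_sum]
      · rw [Finset.sum_const_zero]
    simp only [dist]
    rw [Finset.sum_comm]
    refine Finset.sum_congr rfl fun R _ => Finset.sum_congr rfl fun S _ => ?_
    split_ifs
    · rw [smul_comm, sub_right_comm]
    · rw [smul_zero]
    · rw [smul_zero]
    · rfl
  have split : ∀ (P : Rect n → Prop) [DecidablePred P] (e : ℤ) (a : Rect n → ℤ)
      (A B : Rect n → CD n k), (∑ R, if P R then a R • (A R + e • B R) else 0) =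
        (∑ R, if P R then a R • A R else 0) + e • ∑ R, if P R then a R • B R else 0 := by
    intro P _ e a A B
    rw [Finset.smul_sum, ← Finset.sum_add_distrib]
    refine Finset.sum_congr rfl fun R _ => ?_
    split_ifs
    · rw [smul_add, smul_comm]
    · rw [smul_zero, add_zero]
  rw [delta_domainChain, map_add, map_smul, map_sum, map_sum]
  simp only [apply_ite (delta s k), map_zero, map_smul, delta_domainChain, split]
  have swap := annuli y x (fun i => domainChain k x y (C - rowChain i.1) -
    domainChain k x y (C - columnChain i.1))
  beta_reduce at swap
  rw [front, back, mixed, swap, pow_succ (-1 : ℤ) (k + 1)]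
  have h1 : (-1 : ℤ) ^ (k + 1) * (-1) ^ (k + 1) = 1 := by
    rw [← mul_pow]; simp
  -- Here `T` is the annulus sum and `V` the mixed sum. Two back removals carry the sign `(-1)^(k+2)
  -- (-1)^(k+1) = -1`, against `1` for two front removals.
  have fin : ∀ T V : CD n k, T + (-1 : ℤ) ^ (k + 1) • V +
      ((-1 : ℤ) ^ (k + 1) * -1) • (V + (-1 : ℤ) ^ (k + 1) • T) = 0 := by
    intro T V
    rw [smul_add, smul_smul, mul_right_comm, h1, mul_neg_one, neg_smul, one_mul, neg_smul,
      one_smul]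
    abel
  exact fin _ _

/-! ### Second differences and forced thin rectangles -/

theorem val_last : (last n).val = n - 1 := rfl

theorem val_add_one_of_ne_last {i : Fin n} (h : i ≠ last n) : (i + 1).val = i.val + 1 := by
  have h0 := Fin.val_ne_of_ne h
  have h1 := i.isLt
  rw [val_last] at h0
  rw [Fin.val_add, Fin.val_one', Nat.add_mod_mod]
  exact Nat.mod_eq_of_lt (by omega)

theorem sub_one_eq_last {i : Fin n} (h : i.val = 0) : i - 1 = last n := by
  rw [sub_eq_iff_eq_add]
  refine Fin.ext ?_
  have h1 := i.isLt
  rw [Fin.val_add, Fin.val_one', Nat.add_mod_mod, val_last, h, Nat.sub_add_cancel (by omega),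
    Nat.mod_self]

theorem val_sub_one {i : Fin n} (h : i.val ≠ 0) : (i - 1).val + 1 = i.val := by
  have h1 : i - 1 ≠ last n := by
    intro e
    have h2 := congrArg Fin.val (sub_eq_iff_eq_add.1 e)
    have h3 := i.isLt
    rw [Fin.val_add, Fin.val_one', Nat.add_mod_mod, val_last, Nat.sub_add_cancel (by omega),
      Nat.mod_self] at h2
    exact h h2
  rw [← val_add_one_of_ne_last h1, sub_add_cancel]

/-- Minus the second difference of a cyclic sequence. -/
def bump (t : Fin n → ℤ) (i : Fin n) : ℤ := 2 * t i - t (i - 1) - t (i + 1)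

/-- A column `i` along which every domain with final state `y` and top row `t`, starting at a state
that ascends at `i`, contains the rectangle of width one. -/
def Splits (y : State n) (t : Fin n → ℤ) (i : Fin n) : Prop :=
  1 ≤ bump t i ∨ (0 ≤ bump t i ∧ y (i + 1) < y i)

/-- This is the difference of the domain conditions at the two ends of the bottom edge of the square
`(i, r)`. -/
theorem bump_sub {x y : State n} {C : Chain n} (h : IsDomain x y C) (i r : Fin n) :
    bump (fun c => C c r) i - bump (fun c => C c (r - 1)) i =
      statePoint x i r - statePoint x (i + 1) r + statePoint y (i + 1) r - statePoint y i r := by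
  have h1 := h i r
  have h2 := h (i + 1) r
  simp only [cornerBoundary, add_sub_cancel_right] at h1 h2
  simp only [bump]
  linarith

theorem ite_le_step (a : Fin n) {r : Fin n} (hr : r.val ≠ 0) :
    (if a ≤ r then (1 : ℤ) else 0) = (if a ≤ r - 1 then 1 else 0) + if a = r then 1 else 0 := by
  have := val_sub_one hr
  simp only [Fin.le_def, Fin.ext_iff]
  split_ifs <;> first | rfl | (exfalso; omega)

omit [NeZero n] in
theorem ite_le_zero (a : Fin n) {r : Fin n} (hr : r.val = 0) :
    (if a ≤ r then (1 : ℤ) else 0) = if a = r then 1 else 0 := by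
  simp only [Fin.le_def, Fin.ext_iff]
  split_ifs <;> first | rfl | (exfalso; omega)

/-- The identity `bump_sub` telescopes upwards from row `0`, whose cyclic predecessor is the last
row. -/
theorem bump_eq {x y : State n} {C : Chain n} (h : IsDomain x y C) (i : Fin n) (m : ℕ) :
    ∀ r : Fin n, r.val = m → bump (fun c => C c r) i = bump (fun c => C c (last n)) i +
      (if x i ≤ r then 1 else 0) - (if x (i + 1) ≤ r then 1 else 0) +
      (if y (i + 1) ≤ r then 1 else 0) - if y i ≤ r then 1 else 0 := by
  induction m with
  | zero =>
    intro r hr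
    have := bump_sub h i r
    simp only [statePoint] at this
    rw [sub_one_eq_last hr] at this
    simp only [ite_le_zero _ hr]
    linarith
  | succ m ih =>
    intro r hr
    have hr0 : r.val ≠ 0 := by omega
    have h1 := bump_sub h i r
    have h2 := ih (r - 1) (by have := val_sub_one hr0; omega)
    simp only [statePoint] at h1
    simp only [ite_le_step _ hr0]
    linarith

/-- Between `x i` and `x (i + 1)` the initial state contributes `+1` to the bump. The final state
contributes at least `-1`, and at least `0` if `y` descends at `i`. In both cases of `Splits` the
bump is therefore positive, so `2 * C i r` exceeds the sum of the two neighbouring coefficients,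
which is nonnegative. -/
theorem one_le_of_splits {x y : State n} {C : Chain n} (h : IsDomain x y C)
    (h0 : ∀ c r, 0 ≤ C c r) {i r : Fin n} (hs : Splits y (fun c => C c (last n)) i)
    (h1 : x i ≤ r) (h2 : r < x (i + 1)) : 1 ≤ C i r := by
  have hb := bump_eq h i r.val r rfl
  rw [if_pos h1, if_neg (not_le.2 h2)] at hb
  have e1 := h0 (i - 1) r
  have e2 := h0 (i + 1) r
  have hbr : bump (fun c => C c r) i = 2 * C i r - C (i - 1) r - C (i + 1) r := rfl
  rw [Splits] at hs
  simp only [Fin.le_def, Fin.lt_def] at *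
  split_ifs at hb <;> omega

/-- Reflection in the diagonal inverts the permutations; it transfers the statement about columns to
rows. -/
theorem IsDomain.transpose {x y : State n} {C : Chain n} (h : IsDomain x y C) :
    IsDomain x.symm y.symm (fun c r => C r c) := by
  intro c r
  have := h r c
  simp only [cornerBoundary, statePoint] at *
  rw [if_congr (y.symm_apply_eq.trans eq_comm) rfl rfl,
    if_congr (x.symm_apply_eq.trans eq_comm) rfl rfl]
  linarith

/-- A column (`inl`) or a row (`inr`), other than the last one. -/
abbrev Line (n : ℕ) [NeZero n] : Type := {i : Fin n // i ≠ last n} ⊕ {i : Fin n // i ≠ last n}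

/-- The rectangle of width one in the given column or row. -/
def thin (x : State n) : Line n → Rect n
  | .inl i => columnRect x i.1 i.2
  | .inr i => rowRect x i.1 i.2

/-- The state `x` ascends along the given column or row. -/
def Ascends (x : State n) : Line n → Prop
  | .inl i => x i.1 < x (i.1 + 1)
  | .inr i => x.symm i.1 < x.symm (i.1 + 1)

@[simp] theorem thin_src (x : State n) (l : Line n) : (thin x l).src = x := by
  cases l <;> rfl

theorem ascends_thin_tgt (x : State n) (l : Line n) :
    Ascends (thin x l).tgt l ↔ ¬ Ascends x l := by
  rcases l with ⟨i, hi⟩ | ⟨i, hi⟩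
  · have h := columnRect_tgt x i hi
    simp only [thin, Ascends]
    rw [h.1, h.2, not_lt]
    have := x.injective.ne (add_one_ne_self hi)
    exact ⟨le_of_lt, fun h => lt_of_le_of_ne h this.symm⟩
  · have h := rowRect_tgt_symm x i hi
    simp only [thin, Ascends]
    rw [h.1, h.2, not_lt]
    have := x.symm.injective.ne (add_one_ne_self hi)
    exact ⟨le_of_lt, fun h => lt_of_le_of_ne h this.symm⟩

/-- The two thin rectangles fill an annulus, which is a domain from `x` to itself. -/
theorem thin_thin_tgt (x : State n) (l : Line n) : (thin (thin x l).tgt l).tgt = x := by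
  rcases l with ⟨i, hi⟩ | ⟨i, hi⟩
  · have hd := Rect.isDomain_add (R := columnRect x i hi)
      (S := columnRect (columnRect x i hi).tgt i hi) rfl
    rw [columnRect_add] at hd
    exact hd.tgt_unique (isDomain_column x i)
  · have hd := Rect.isDomain_add (R := rowRect x i hi)
      (S := rowRect (rowRect x i hi).tgt i hi) rfl
    rw [rowRect_add] at hd
    exact hd.tgt_unique (isDomain_row x i)

/-! ### Planar rectangles -/

/-- A 2-chain is planar if it vanishes on the last row and on the last column. -/
def IsPlanar (C : Chain n) : Prop := (∀ c, C c (last n) = 0) ∧ ∀ r, C (last n) r = 0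

omit [NeZero n] in
theorem inArc_iff_of_lt {i j k : Fin n} (h : i < j) : InArc i j k ↔ i ≤ k ∧ k < j := by
  rw [inArc_iff]
  simp only [Fin.le_def, Fin.lt_def] at *
  omega

theorem not_inArc_last {i j : Fin n} (h : i ≠ j) : ¬ InArc i j (last n) ↔ i < j := by
  have h1 := i.isLt
  have h2 := j.isLt
  have h3 := Fin.val_ne_of_ne h
  rw [inArc_iff, Fin.lt_def, val_last]
  omega

theorem Rect.isPlanar_iff (R : Rect n) :
    IsPlanar R.chain ↔ R.left < R.right ∧ R.src R.left < R.src R.right := by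
  have hne := R.src.injective.ne R.ne
  simp only [IsPlanar, Rect.chain, boxChain_eq_zero_iff]
  rw [← not_inArc_last R.ne, ← not_inArc_last hne]
  constructor
  · exact fun h => ⟨fun h1 => h.2 _ ⟨h1, inArc_left hne⟩, fun h1 => h.1 _ ⟨inArc_left R.ne, h1⟩⟩
  · exact fun h => ⟨fun c hc => h.2 hc.2, fun r hr => h.1 hr.1⟩

theorem thin_isPlanar {x : State n} {l : Line n} (h : Ascends x l) :
    IsPlanar (thin x l).chain := by
  rw [Rect.isPlanar_iff]
  rcases l with ⟨i, hi⟩ | ⟨i, hi⟩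
  · refine ⟨?_, h⟩
    change i < i + 1
    rw [Fin.lt_def, val_add_one_of_ne_last hi]
    omega
  · refine ⟨h, ?_⟩
    change x (x.symm i) < x (x.symm (i + 1))
    rw [x.apply_symm_apply, x.apply_symm_apply, Fin.lt_def, val_add_one_of_ne_last hi]
    omega

theorem Rect.not_mem_of_isPlanar {R : Rect n} (h : IsPlanar R.chain) {k : Fin n}
    (h1 : k ≠ R.left) (h2 : k ≠ R.right) :
    ¬ ((R.left < k ∧ k < R.right) ∧ R.src R.left < R.src k ∧ R.src k < R.src R.right) := by
  rw [Rect.isPlanar_iff] at h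
  have := R.empty k h1 h2
  rw [boxChain_eq_zero_iff, inArc_iff_of_lt h.1, inArc_iff_of_lt h.2] at this
  exact fun hh => this ⟨⟨hh.1.1.le, hh.1.2⟩, hh.2.1.le, hh.2.2⟩

omit [NeZero n] in
theorem val_apply_eq_iff (x : State n) (i j : Fin n) :
    (x i).val = (x j).val ↔ i.val = j.val := by
  rw [← Fin.ext_iff, ← Fin.ext_iff, x.injective.eq_iff]

/-- If a planar rectangle reverses the order, by columns or by rows, of two points `(p, x p)` and
`(q, x q)` that are adjacent in that order, then these are its corners. -/
theorem Rect.corners_of_isPlanar {R : Rect n} (h : IsPlanar R.chain) {p q : Fin n} (hpq : p < q)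
    (hx : R.src p < R.src q)
    (h2 : (q.val = p.val + 1 ∧
        R.src (Equiv.swap R.left R.right q) ≤ R.src (Equiv.swap R.left R.right p)) ∨
      ((R.src q).val = (R.src p).val + 1 ∧
        Equiv.swap R.left R.right q ≤ Equiv.swap R.left R.right p)) :
    R.left = p ∧ R.right = q := by
  have hp := R.isPlanar_iff.1 h
  have e1 := R.not_mem_of_isPlanar h (k := p)
  have e2 := R.not_mem_of_isPlanar h (k := q)
  have f1 := val_apply_eq_iff R.src p R.left
  have f2 := val_apply_eq_iff R.src p R.right
  have f3 := val_apply_eq_iff R.src q R.left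
  have f4 := val_apply_eq_iff R.src q R.right
  generalize R.left = a at *
  generalize R.right = b at *
  have swap_ne : ∀ k, k ≠ a → k ≠ b → Equiv.swap a b k = k := fun k h1 h2 =>
    Equiv.swap_apply_of_ne_of_ne h1 h2
  have done : ∀ {u v : Fin n}, Equiv.swap a b p = u → Equiv.swap a b q = v →
      (q.val = p.val + 1 ∧ (R.src v).val ≤ (R.src u).val) ∨
      ((R.src q).val = (R.src p).val + 1 ∧ v.val ≤ u.val) := by
    rintro u v rfl rfl
    exact h2
  clear h2
  simp only [Fin.lt_def, Fin.ext_iff, ne_eq] at *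
  -- Unless `p` and `q` are the two corners in this order, either the order of the two points
  -- persists or one of them lies inside the empty rectangle.
  by_cases a1 : p.val = a.val
  · have hs : (Equiv.swap a b p).val = b.val := by rw [Fin.ext a1, Equiv.swap_apply_left]
    by_cases a2 : q.val = b.val
    · exact ⟨a1.symm, a2.symm⟩
    · have := done hs (swap_ne q (by omega) a2)
      omega
  · exfalso
    by_cases a2 : p.val = b.val
    · have hs : (Equiv.swap a b p).val = a.val := by rw [Fin.ext a2, Equiv.swap_apply_right]
      have := done hs (swap_ne q (by omega) (by omega))
      omega
    · have hs := swap_ne p a1 a2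
      by_cases a3 : q.val = a.val
      · have := done hs (by rw [Fin.ext a3, Equiv.swap_apply_left])
        omega
      · by_cases a4 : q.val = b.val
        · have := done hs (by rw [Fin.ext a4, Equiv.swap_apply_right])
          omega
        · have := done hs (swap_ne q a3 a4)
          omega

/-- The only planar rectangle that turns an ascent along a line into a descent is the one of
width one. -/
theorem Rect.eq_thin {R : Rect n} {l : Line n} (h : IsPlanar R.chain) (h1 : Ascends R.src l)
    (h2 : ¬ Ascends R.tgt l) : R = thin R.src l := by
  rcases l with ⟨i, hi⟩ | ⟨j, hj⟩
  · have hv := val_add_one_of_ne_last hi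
    have := Rect.corners_of_isPlanar h (p := i) (q := i + 1) (by rw [Fin.lt_def]; omega) h1
      (.inl ⟨hv, not_lt.1 h2⟩)
    exact Rect.ext rfl this.1 this.2
  · have hv := val_add_one_of_ne_last hj
    have := Rect.corners_of_isPlanar h (p := R.src.symm j) (q := R.src.symm (j + 1)) h1
      (by rw [R.src.apply_symm_apply, R.src.apply_symm_apply, Fin.lt_def]; omega)
      (.inr ⟨by rw [R.src.apply_symm_apply, R.src.apply_symm_apply, hv], not_lt.1 h2⟩)
    exact Rect.ext rfl this.1 this.2


/-! ### Splitting lines and the rank of a domain -/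

/-- A line splits a domain if its thin rectangles are forced to be contained in the domain, in
terms of its final state, top row and right column. -/
def LineSplits (y : State n) (t u : Fin n → ℤ) : Line n → Prop
  | .inl i => Splits y t i.1
  | .inr i => Splits y.symm u i.1

open Classical in
/-- A choice of splitting line, if there is one. -/
noncomputable def splittingLine (y : State n) (t u : Fin n → ℤ) : Option (Line n) :=
  if h : ∃ l, LineSplits y t u l then some h.choose else none

/-- The splitting line of a domain. -/
noncomputable def PosDomain.line (D : PosDomain n) : Option (Line n) :=
  splittingLine D.tgt (fun c => D.chain c (last n)) (D.chain (last n))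

theorem lineSplits_of_line_eq {D : PosDomain n} {l : Line n} (h : D.line = some l) :
    LineSplits D.tgt (fun c => D.chain c (last n)) (D.chain (last n)) l := by
  unfold PosDomain.line splittingLine at h
  split_ifs at h with h1
  · rw [← Option.some.inj h]; exact h1.choose_spec

theorem not_lineSplits_of_line_eq {D : PosDomain n} (h : D.line = none) (l : Line n) :
    ¬ LineSplits D.tgt (fun c => D.chain c (last n)) (D.chain (last n)) l := by
  unfold PosDomain.line splittingLine at h
  split_ifs at h with h1
  exact fun hl => h1 ⟨l, hl⟩

/-- The domains that ascend along their splitting line. -/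
def PosDomain.IsUpper (D : PosDomain n) : Prop := ∃ l, D.line = some l ∧ Ascends D.src l

/-- The domains that descend along their splitting line. -/
def PosDomain.IsLower (D : PosDomain n) : Prop := ∃ l, D.line = some l ∧ ¬ Ascends D.src l

/-- The choice of line depends only on the final state, the top row and the right column, and none
of these changes when a planar rectangle is removed at the front. -/
theorem PosDomain.line_eq_of_isPlanar {D E : PosDomain n} {R : Rect n} (h : D.tgt = E.tgt)
    (hc : ∀ c r, E.chain c r = D.chain c r - R.chain c r) (hR : IsPlanar R.chain) :
    E.line = D.line := by
  unfold PosDomain.line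
  rw [h]
  congr 1
  · funext c; rw [hc, hR.1, sub_zero]
  · funext r; rw [hc, hR.2, sub_zero]

theorem thin_le {D : PosDomain n} {l : Line n} (h : D.line = some l) (ha : Ascends D.src l)
    (c r : Fin n) : (thin D.src l).chain c r ≤ D.chain c r := by
  have hl := lineSplits_of_line_eq h
  rcases l with ⟨i, hi⟩ | ⟨i, hi⟩
  · change (columnRect D.src i hi).chain c r ≤ _
    rw [columnRect_chain, arcInd, if_congr (inArc_iff_of_lt ha) rfl rfl]
    split_ifs with h1 h2
    · subst h1
      exact one_le_of_splits D.isDomain D.nonneg hl h2.1 h2.2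
    · exact D.nonneg c r
    · exact D.nonneg c r
  · change (rowRect D.src i hi).chain c r ≤ _
    rw [rowRect_chain, arcInd, if_congr (inArc_iff_of_lt ha) rfl rfl]
    split_ifs with h1 h2
    · subst h1
      exact one_le_of_splits D.isDomain.transpose (fun a b => D.nonneg b a) hl h2.1 h2.2
    · exact D.nonneg c r
    · exact D.nonneg c r

/-- The sum of the coefficients in the top row and in the right column. -/
def border (C : Chain n) : ℤ := ∑ c, C c (last n) + ∑ r, C (last n) r

theorem border_nonneg {C : Chain n} (h : ∀ c r, 0 ≤ C c r) : 0 ≤ border C :=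
  add_nonneg (Finset.sum_nonneg fun _ _ => h _ _) (Finset.sum_nonneg fun _ _ => h _ _)

theorem border_sub (C D : Chain n) : border (fun c r => C c r - D c r) = border C - border D := by
  simp only [border, Finset.sum_sub_distrib]; ring

theorem border_eq_zero_iff {C : Chain n} (h : ∀ c r, 0 ≤ C c r) :
    border C = 0 ↔ IsPlanar C := by
  rw [border, add_eq_zero_iff_of_nonneg (Finset.sum_nonneg fun _ _ => h _ _)
    (Finset.sum_nonneg fun _ _ => h _ _), Finset.sum_eq_zero_iff_of_nonneg fun _ _ => h _ _,
    Finset.sum_eq_zero_iff_of_nonneg fun _ _ => h _ _]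
  simp [IsPlanar]

/-- A statistic of states that increases along planar rectangles. -/
def stat (x : State n) : ℕ := ∑ i, (n - i.val) * (x i).val

/-- Exchanging the two values moves the larger one to the column of larger weight; the increase is
the width times the height of the rectangle. -/
theorem Rect.stat_lt {R : Rect n} (h : IsPlanar R.chain) : stat R.src < stat R.tgt := by
  have hp := R.isPlanar_iff.1 h
  have key : ∀ x : State n, stat x = (n - R.left.val) * (x R.left).val +
      ((n - R.right.val) * (x R.right).val +
        ∑ i ∈ (Finset.univ.erase R.left).erase R.right, (n - i.val) * (x i).val) := by
    intro x
    rw [stat, ← Finset.add_sum_erase _ _ (Finset.mem_univ R.left),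
      ← Finset.add_sum_erase _ _ (Finset.mem_erase.2 ⟨R.ne.symm, Finset.mem_univ R.right⟩)]
  have hr : ∑ i ∈ (Finset.univ.erase R.left).erase R.right, (n - i.val) * (R.tgt i).val =
      ∑ i ∈ (Finset.univ.erase R.left).erase R.right, (n - i.val) * (R.src i).val := by
    refine Finset.sum_congr rfl fun i hi => ?_
    simp only [Finset.mem_erase] at hi
    rw [Rect.tgt, Equiv.trans_apply, Equiv.swap_apply_of_ne_of_ne hi.2.1 hi.1]
  rw [key, key, hr, ← add_assoc, ← add_assoc, add_lt_add_iff_right]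
  simp only [Rect.tgt, Equiv.trans_apply, Equiv.swap_apply_left, Equiv.swap_apply_right]
  simp only [Fin.lt_def] at hp
  have h1 := R.right.isLt
  obtain ⟨a, ha⟩ := Nat.exists_eq_add_of_lt hp.1
  obtain ⟨b, hb⟩ := Nat.exists_eq_add_of_lt hp.2
  obtain ⟨e, he⟩ := Nat.exists_eq_add_of_lt h1
  rw [hb, show n - R.left.val = (e + 1) + (a + 1) by omega, show n - R.right.val = e + 1 by omega]
  nlinarith

/-- The rank of a domain; it is preserved by removing an initial planar rectangle, and decreased by
removing any other initial or final rectangle. -/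
def PosDomain.rank (D : PosDomain n) : ℕ ×ₗ ℕ := toLex ((border D.chain).toNat, stat D.tgt)

/-- A rectangle that is not planar uses a square of the top row or right column, so the first
component of the rank drops. -/
theorem rank_lt_of_not_isPlanar {D E : PosDomain n} {R : Rect n}
    (hc : ∀ c r, E.chain c r = D.chain c r - R.chain c r) (hR : ¬ IsPlanar R.chain) :
    E.rank < D.rank := by
  have h1 := border_sub D.chain R.chain
  have h2 := border_nonneg E.nonneg
  have h3 := border_nonneg R.chain_nonneg
  have h4 := mt (border_eq_zero_iff R.chain_nonneg).1 hR
  rw [show (fun c r => D.chain c r - R.chain c r) = E.chain from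
    funext fun c => funext fun r => (hc c r).symm] at h1
  exact Prod.Lex.toLex_lt_toLex.2 (.inl (by dsimp only; omega))

theorem border_eq_of_isPlanar {D E : PosDomain n} {R : Rect n}
    (hc : ∀ c r, E.chain c r = D.chain c r - R.chain c r) (hR : IsPlanar R.chain) :
    border E.chain = border D.chain := by
  have h1 := border_sub D.chain R.chain
  rw [show (fun c r => D.chain c r - R.chain c r) = E.chain from
    funext fun c => funext fun r => (hc c r).symm, (border_eq_zero_iff R.chain_nonneg).2 hR,
    sub_zero] at h1
  exact h1

/-- A planar final rectangle leaves the border unchanged but moves the final state back to one of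
smaller `stat`; this is what the second component of the rank is for. -/
theorem rank_removeFinal_lt {D : PosDomain n} {R : Rect n} (h : R.IsFinal D) :
    (D.removeFinal R h).rank < D.rank := by
  by_cases hR : IsPlanar R.chain
  · refine Prod.Lex.toLex_lt_toLex.2 (.inr ⟨?_, ?_⟩)
    · dsimp only
      rw [border_eq_of_isPlanar (D := D) (E := D.removeFinal R h) (fun _ _ => rfl) hR]
    · change stat R.src < stat D.tgt
      rw [← h.1]
      exact Rect.stat_lt hR
  · exact rank_lt_of_not_isPlanar (D := D) (E := D.removeFinal R h) (fun _ _ => rfl) hR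

theorem rank_eq_of_isPlanar {D E : PosDomain n} {R : Rect n} (ht : D.tgt = E.tgt)
    (hc : ∀ c r, E.chain c r = D.chain c r - R.chain c r) (hR : IsPlanar R.chain) :
    E.rank = D.rank := by
  rw [PosDomain.rank, PosDomain.rank, border_eq_of_isPlanar hc hR, ht]

/-- Removing an initial rectangle from an upper domain gives a lower domain of the same rank only
for the thin rectangle. -/
theorem eq_thin_or_rank_lt {D : PosDomain n} {l : Line n} (hl : D.line = some l)
    (ha : Ascends D.src l) {R : Rect n} (h : R.IsInitial D) (hE : (D.removeInitial R h).IsLower) :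
    R = thin D.src l ∨ (D.removeInitial R h).rank < D.rank := by
  by_cases hR : IsPlanar R.chain
  · left
    obtain ⟨l', h1, h2⟩ := hE
    rw [PosDomain.line_eq_of_isPlanar (D := D) (E := D.removeInitial R h) rfl (fun _ _ => rfl) hR,
      hl] at h1
    obtain rfl := Option.some.inj h1
    rw [← h.1] at ha
    exact (Rect.eq_thin hR ha h2).trans (by rw [h.1])
  · exact .inr (rank_lt_of_not_isPlanar (D := D) (E := D.removeInitial R h) (fun _ _ => rfl) hR)

/-! ### The unique domain without a splitting line -/

/-- Along a cyclic sequence that is nonnegative, zero at the end and without positive bumps,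
everything vanishes. -/
theorem eq_zero_of_bump_nonpos {t : Fin n → ℤ} (h0 : ∀ i, 0 ≤ t i) (hl : t (last n) = 0)
    (hb : ∀ i, i ≠ last n → bump t i ≤ 0) (i : Fin n) : t i = 0 := by
  classical
  obtain ⟨m, hm⟩ := Finite.exists_max t
  by_contra hi
  have hpos : 0 < t m := lt_of_lt_of_le (lt_of_le_of_ne (h0 i) (Ne.symm hi)) (hm i)
  -- At the first index where a positive maximum is attained, the predecessor has a strictly smaller
  -- value (for index `0` the predecessor is the last index, where `t` vanishes), so the bump is
  -- positive.
  have hex : ∃ k : ℕ, ∃ j : Fin n, j.val = k ∧ t j = t m := ⟨_, m, rfl, rfl⟩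
  obtain ⟨j, hj, hjm⟩ := Nat.find_spec hex
  have hmin : ∀ j' : Fin n, t j' = t m → j.val ≤ j'.val := fun j' h' =>
    hj ▸ Nat.find_min' hex ⟨j', rfl, h'⟩
  have hjl : j ≠ last n := by rintro rfl; omega
  have h1 := hb j hjl
  have h2 := hm (j + 1)
  have h3 := hm (j - 1)
  have h4 : t (j - 1) ≠ t m := by
    by_cases hz : j.val = 0
    · rw [sub_one_eq_last hz, hl]; omega
    · intro e
      have := hmin _ e
      have := val_sub_one hz
      omega
  have h5 : bump t j = 2 * t j - t (j - 1) - t (j + 1) := rfl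
  omega


theorem eq_refl_of_ascends {y : State n} (h : ∀ i, i ≠ last n → y i < y (i + 1)) :
    y = Equiv.refl (Fin n) := by
  have key : ∀ d : ℕ, ∀ i j : Fin n, j.val = i.val + d + 1 → y i < y j := by
    intro d
    induction d with
    | zero =>
      intro i j hij
      have hi : i ≠ last n := by
        rintro rfl; have := j.isLt; rw [val_last] at hij; omega
      rw [show j = i + 1 from Fin.ext (by rw [val_add_one_of_ne_last hi]; omega)]
      exact h i hi
    | succ d ih =>
      intro i j hij
      have hi : i ≠ last n := by
        rintro rfl; have := j.isLt; rw [val_last] at hij; omega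
      exact (h i hi).trans (ih _ _ (by rw [val_add_one_of_ne_last hi]; omega))
  have hm : StrictMono y := fun i j hij => by
    obtain ⟨d, hd⟩ := Nat.exists_eq_add_of_lt (Fin.lt_def.1 hij)
    exact key d i j hd
  have := Subsingleton.elim (hm.orderIsoOfSurjective y y.surjective) (OrderIso.refl _)
  exact Equiv.ext fun i => congrArg (fun e : Fin n ≃o Fin n => e i) this

theorem exists_descent {y : State n} (h : y ≠ Equiv.refl (Fin n)) :
    ∃ i, i ≠ last n ∧ y (i + 1) < y i := by
  by_contra hc
  push Not at hc
  exact h (eq_refl_of_ascends fun i hi =>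
    lt_of_le_of_ne (hc i hi) (y.injective.ne (add_one_ne_self hi)))

/-- Summation by parts; the wrap-around term disappears because `G` vanishes at the last index. -/
theorem sum_val_mul_sub {G : Fin n → ℤ} (h : G (last n) = 0) :
    ∑ c : Fin n, (c.val : ℤ) * (G (c - 1) - G c) = ∑ c, G c := by
  have h1 : ∑ c : Fin n, (c.val : ℤ) * G (c - 1) = ∑ c : Fin n, ((c + 1).val : ℤ) * G c := by
    rw [← Equiv.sum_comp (Equiv.addRight (1 : Fin n))]
    simp
  simp only [mul_sub, Finset.sum_sub_distrib]
  rw [h1, ← Finset.sum_sub_distrib]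
  refine Finset.sum_congr rfl fun c _ => ?_
  by_cases hc : c = last n
  · rw [hc, h]; ring
  · rw [val_add_one_of_ne_last hc]; push_cast; ring

/-- A positive domain to the identity state that vanishes on the top row and on the right column is
trivial. -/
theorem eq_const_of_isPlanar {D : PosDomain n} (ht : D.tgt = Equiv.refl (Fin n))
    (hp : IsPlanar D.chain) : D = PosDomain.const (Equiv.refl (Fin n)) := by
  -- The domain condition is paired with the weight `c * r` and summed by parts in both directions,
  -- which yields the total area of the domain.
  have h1 : ∀ r, ∑ c : Fin n, (c.val : ℤ) * cornerBoundary D.chain c r =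
      ∑ c, (D.chain c r - D.chain c (r - 1)) := fun r =>
    sum_val_mul_sub (G := fun c => D.chain c r - D.chain c (r - 1)) (by simp [hp.2])
  have h2 : ∑ r : Fin n, (r.val : ℤ) * ∑ c, (D.chain c r - D.chain c (r - 1)) =
      -∑ c, ∑ r, D.chain c r := by
    simp only [Finset.mul_sum]
    rw [Finset.sum_comm, ← Finset.sum_neg_distrib]
    refine Finset.sum_congr rfl fun c _ => ?_
    rw [← sum_val_mul_sub (G := D.chain c) (hp.1 c), ← Finset.sum_neg_distrib]
    refine Finset.sum_congr rfl fun r _ => ?_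
    ring
  have h3 : ∀ z : State n, ∑ r : Fin n, (r.val : ℤ) * ∑ c : Fin n, (c.val : ℤ) * statePoint z c r =
      ∑ c : Fin n, (c.val : ℤ) * (z c).val := by
    intro z
    simp only [Finset.mul_sum]
    rw [Finset.sum_comm]
    refine Finset.sum_congr rfl fun c _ => ?_
    simp [statePoint, mul_comm]
  have h4 : ∑ c : Fin n, (c.val : ℤ) * c.val - ∑ c : Fin n, (c.val : ℤ) * (D.src c).val =
      -∑ c, ∑ r, D.chain c r := by
    rw [← h2, ← h3 D.src]
    have := h3 (Equiv.refl (Fin n))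
    simp only [Equiv.refl_apply] at this
    rw [← this, ← Finset.sum_sub_distrib]
    refine Finset.sum_congr rfl fun r _ => ?_
    rw [← h1, ← mul_sub, ← Finset.sum_sub_distrib]
    congr 1
    refine Finset.sum_congr rfl fun c _ => ?_
    rw [D.isDomain, ht]; ring
  have h5 : ∑ c : Fin n, ((D.src c).val : ℤ) * (D.src c).val = ∑ c : Fin n, (c.val : ℤ) * c.val :=
    Equiv.sum_comp D.src (fun c => (c.val : ℤ) * c.val)
  -- A permutation preserves the sum of squares, so a sum of squares equals minus twice the area;
  -- both must vanish.
  have h6 : ∑ c : Fin n, ((c.val : ℤ) - (D.src c).val) ^ 2 = -2 * ∑ c, ∑ r, D.chain c r := by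
    have : ∀ c : Fin n, ((c.val : ℤ) - (D.src c).val) ^ 2 = (c.val : ℤ) * c.val +
        ((D.src c).val : ℤ) * (D.src c).val - 2 * ((c.val : ℤ) * (D.src c).val) := fun c => by ring
    simp only [this, Finset.sum_sub_distrib, Finset.sum_add_distrib, ← Finset.mul_sum, h5]
    linarith
  have h7 : 0 ≤ ∑ c : Fin n, ((c.val : ℤ) - (D.src c).val) ^ 2 :=
    Finset.sum_nonneg fun _ _ => sq_nonneg _
  have h8 : ∀ c ∈ Finset.univ, 0 ≤ ∑ r, D.chain c r :=
    fun c _ => Finset.sum_nonneg fun r _ => D.nonneg c r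
  have h9 : ∑ c, ∑ r, D.chain c r = 0 := le_antisymm (by linarith) (Finset.sum_nonneg h8)
  have hC : ∀ c r, D.chain c r = 0 := fun c r =>
    (Finset.sum_eq_zero_iff_of_nonneg fun r _ => D.nonneg c r).1
      ((Finset.sum_eq_zero_iff_of_nonneg h8).1 h9 c (Finset.mem_univ _)) r (Finset.mem_univ _)
  refine PosDomain.ext ?_ ht (funext fun c => funext fun r => hC c r)
  refine statePoint_injective fun c r => ?_
  have := D.isDomain c r
  simp only [cornerBoundary, hC, ht] at this
  change statePoint D.src c r = statePoint (Equiv.refl _) c r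
  linarith

/-- The first alternative of `Splits` failing on every line makes the border vanish; then all bumps
there are zero, and the second alternative failing excludes descents of the final state. -/
theorem eq_const_of_line_eq_none {D : PosDomain n} (h : D.line = none) :
    D = PosDomain.const (Equiv.refl (Fin n)) := by
  have hs := not_lineSplits_of_line_eq h
  have htop : ∀ c, D.chain c (last n) = 0 :=
    eq_zero_of_bump_nonpos (t := fun c => D.chain c (last n)) (fun i => D.nonneg _ _) D.avoid
      fun i hi => by
        by_contra hh
        exact hs (.inl ⟨i, hi⟩) (.inl (Order.one_le_iff_pos.2 (not_le.1 hh)))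
  have hright : ∀ r, D.chain (last n) r = 0 :=
    eq_zero_of_bump_nonpos (t := D.chain (last n)) (fun i => D.nonneg _ _) D.avoid
      fun i hi => by
        by_contra hh
        exact hs (.inr ⟨i, hi⟩) (.inl (Order.one_le_iff_pos.2 (not_le.1 hh)))
  refine eq_const_of_isPlanar ?_ ⟨htop, hright⟩
  by_contra hne
  obtain ⟨i, hi, hd⟩ := exists_descent hne
  exact hs (.inl ⟨i, hi⟩) (.inr ⟨by simp [bump, htop], hd⟩)

theorem line_const : (PosDomain.const (Equiv.refl (Fin n))).line = none := by
  cases h : (PosDomain.const (Equiv.refl (Fin n))).line with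
  | none => rfl
  | some l =>
    exfalso
    have hl := lineSplits_of_line_eq h
    rcases l with ⟨i, hi⟩ | ⟨i, hi⟩
    all_goals
      rcases hl with hl | ⟨-, hl⟩
      · simp [bump, PosDomain.const] at hl
      · change i + 1 < i at hl
        rw [Fin.lt_def, val_add_one_of_ne_last hi] at hl
        omega

/-! ### Integrality of the Maslov index -/

/-- The rectangle of width one ending at a state that descends along the given line. -/
def thinTo (x : State n) (l : Line n) : Rect n := thin (thin x l).tgt l

theorem thinTo_tgt (x : State n) (l : Line n) : (thinTo x l).tgt = x := thin_thin_tgt x l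

theorem thinTo_isPlanar {x : State n} {l : Line n} (h : ¬ Ascends x l) :
    IsPlanar (thinTo x l).chain := thin_isPlanar ((ascends_thin_tgt x l).2 h)

theorem exists_not_ascends {y : State n} (h : y ≠ Equiv.refl (Fin n)) :
    ∃ l, ¬ Ascends y l := by
  obtain ⟨i, hi, hd⟩ := exists_descent h
  exact ⟨.inl ⟨i, hi⟩, not_lt.2 hd.le⟩

/-- A state other than the identity has a descent, hence is the end of a thin planar rectangle
starting at a state of smaller `stat`. The result serves as a reference domain of integral index. -/
theorem exists_domain_from_refl (N : ℕ) : ∀ y : State n, stat y ≤ N → ∃ D : PosDomain n,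
    D.src = Equiv.refl (Fin n) ∧ D.tgt = y ∧ ∃ k : ℤ, D.maslov = k := by
  induction N with
  | zero =>
    intro y hy
    by_cases h : y = Equiv.refl (Fin n)
    · exact ⟨PosDomain.const _, rfl, h.symm, 0, by rw [PosDomain.maslov_const]; simp⟩
    · obtain ⟨l, hl⟩ := exists_not_ascends h
      have := (thinTo y l).stat_lt (thinTo_isPlanar hl)
      rw [thinTo_tgt] at this
      omega
  | succ N ih =>
    intro y hy
    by_cases h : y = Equiv.refl (Fin n)
    · exact ⟨PosDomain.const _, rfl, h.symm, 0, by rw [PosDomain.maslov_const]; simp⟩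
    · obtain ⟨l, hl⟩ := exists_not_ascends h
      have := (thinTo y l).stat_lt (thinTo_isPlanar hl)
      rw [thinTo_tgt] at this
      obtain ⟨D, h1, h2, k, h3⟩ := ih (thinTo y l).src (by omega)
      refine ⟨D.append _ h2, h1, thinTo_tgt y l, k + 1, ?_⟩
      rw [PosDomain.maslov_append, h3]
      push_cast; rfl

theorem exists_extend_to_refl (N : ℕ) : ∀ D : PosDomain n, stat D.src ≤ N → ∃ E : PosDomain n,
    E.src = Equiv.refl (Fin n) ∧ E.tgt = D.tgt ∧ ∃ k : ℤ, E.maslov = D.maslov + k := by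
  induction N with
  | zero =>
    intro D hD
    by_cases h : D.src = Equiv.refl (Fin n)
    · exact ⟨D, h, rfl, 0, by simp⟩
    · obtain ⟨l, hl⟩ := exists_not_ascends h
      have := (thinTo D.src l).stat_lt (thinTo_isPlanar hl)
      rw [thinTo_tgt] at this
      omega
  | succ N ih =>
    intro D hD
    by_cases h : D.src = Equiv.refl (Fin n)
    · exact ⟨D, h, rfl, 0, by simp⟩
    · obtain ⟨l, hl⟩ := exists_not_ascends h
      have := (thinTo D.src l).stat_lt (thinTo_isPlanar hl)
      rw [thinTo_tgt] at this
      obtain ⟨E, h1, h2, k, h3⟩ := ih (D.prepend _ (thinTo_tgt D.src l))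
        (show stat (thinTo D.src l).src ≤ N by omega)
      refine ⟨E, h1, h2, k + 1, ?_⟩
      rw [h3, PosDomain.maslov_prepend]
      push_cast; ring

theorem eq_last_of_shift_invariant {α : Type*} {f : Fin n → α} (h : ∀ c, f (c - 1) = f c)
    (c : Fin n) : f c = f (last n) := by
  have : ∀ m : ℕ, ∀ c : Fin n, c.val = m → f c = f (last n) := by
    intro m
    induction m with
    | zero => intro c hc; rw [← h, sub_one_eq_last hc]
    | succ m ih =>
      intro c hc
      have := val_sub_one (i := c) (by omega)
      rw [← h, ih _ (by omega)]
  exact this _ c rfl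

/-- A periodic 2-chain is a combination of rows and columns. -/
theorem eq_of_cornerBoundary_eq_zero {F : Chain n} (h : ∀ c r, cornerBoundary F c r = 0)
    (c r : Fin n) : F c r = F c (last n) + (F (last n) r - F (last n) (last n)) := by
  have h1 : ∀ c r, F c r - F c (r - 1) = F (last n) r - F (last n) (r - 1) := fun c r =>
    eq_last_of_shift_invariant (f := fun c => F c r - F c (r - 1))
      (fun c => by have := h c r; simp only [cornerBoundary] at this; linarith) c
  have h2 := eq_last_of_shift_invariant (f := fun r => F c r - F (last n) r)
    (fun r => by have := h1 c r; linarith) r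
  linarith

/-- A state has one point on each circle, so every row or column contributes exactly its
multiplicity: half from each of its two bounding circles. -/
theorem pointMeasure_periodic {F : Chain n} (h : ∀ c r, cornerBoundary F c r = 0) (x : State n) :
    ∃ k : ℤ, pointMeasure F x = k := by
  have sh : ∀ f : Fin n → ℤ, ∑ c, f (c - 1) = ∑ c, f c := fun f =>
    Equiv.sum_comp (Equiv.subRight (1 : Fin n)) f
  let f : Fin n → ℤ := fun c => F c (last n)
  let g : Fin n → ℤ := fun r => F (last n) r - F (last n) (last n)
  have hF : ∀ c r, F c r = f c + g r := eq_of_cornerBoundary_eq_zero h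
  refine ⟨∑ c, f c + ∑ r, g r, ?_⟩
  have h1 : ∑ i, cornerSum F i (x i) = 4 * (∑ c, f c + ∑ r, g r) := by
    have e : ∀ i, cornerSum F i (x i) =
        2 * (f i + f (i - 1)) + 2 * (g (x i) + g (x i - 1)) := by
      intro i; simp only [cornerSum, hF]; ring
    simp only [e, Finset.sum_add_distrib, ← Finset.mul_sum]
    rw [sh f, Equiv.sum_comp x g, Equiv.sum_comp x (fun r => g (r - 1)), sh g]
    ring
  rw [pointMeasure, ← Finset.sum_div, ← Int.cast_sum, h1]
  push_cast; ring

theorem PosDomain.maslov_nonneg (D : PosDomain n) : 0 ≤ D.maslov := by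
  have : ∀ x, 0 ≤ pointMeasure D.chain x := fun x => Finset.sum_nonneg fun i _ => by
    have h : 0 ≤ cornerSum D.chain i (x i) := by
      have h1 := D.nonneg i (x i)
      have h2 := D.nonneg (i - 1) (x i)
      have h3 := D.nonneg i (x i - 1)
      have h4 := D.nonneg (i - 1) (x i - 1)
      rw [cornerSum]; omega
    have h' : (0 : ℚ) ≤ (cornerSum D.chain i (x i) : ℚ) := by exact_mod_cast h
    positivity
  exact add_nonneg (this _) (this _)

/-- Extending `D` at the front to start at the identity changes its index by an integer. The
extension and the reference domain `G` have the same ends, so they differ by a periodic chain, whose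
point measures are integers. -/
theorem PosDomain.exists_maslov_eq (D : PosDomain n) : ∃ k : ℕ, D.maslov = k := by
  obtain ⟨E, h1, h2, k, hk⟩ := exists_extend_to_refl _ D le_rfl
  obtain ⟨G, h3, h4, l, hl⟩ := exists_domain_from_refl _ D.tgt le_rfl
  have hper : ∀ c r, cornerBoundary (fun c r => E.chain c r - G.chain c r) c r = 0 := by
    intro c r
    rw [E.isDomain.sub G.isDomain, h1, h2, h3, h4]; ring
  have hsub : ∀ x, pointMeasure E.chain x - pointMeasure G.chain x =
      pointMeasure (fun c r => E.chain c r - G.chain c r) x := by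
    intro x
    simp only [pointMeasure, ← Finset.sum_sub_distrib, cornerSum]
    refine Finset.sum_congr rfl fun i _ => ?_
    push_cast; ring
  obtain ⟨a, ha⟩ := pointMeasure_periodic hper (Equiv.refl (Fin n))
  obtain ⟨b, hb⟩ := pointMeasure_periodic hper D.tgt
  have hint : D.maslov = ((l + a + b - k : ℤ) : ℚ) := by
    rw [← hsub] at ha hb
    simp only [PosDomain.maslov] at hk hl ⊢
    rw [h1, h2] at hk
    rw [h3, h4] at hl
    push_cast
    linarith
  have hnn := D.maslov_nonneg
  rw [hint] at hnn
  obtain ⟨m, hm⟩ := Int.eq_ofNat_of_zero_le (a := l + a + b - k) (by exact_mod_cast hnn)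
  exact ⟨m, by rw [hint, hm]; simp⟩


/-! ### Unitriangular maps -/

section
variable {α β ρ : Type*} [LinearOrder ρ] [WellFoundedLT ρ] {U : Set α} {V : Set β}
  {P : α → β → Prop} {a : α → ρ} {b : β → ρ} {d : (α →₀ ℤ) →ₗ[ℤ] (β →₀ ℤ)}

/-- If the `V`-part of a linear map, restricted to `U`, is unitriangular with respect to a matching
of `U` with `V`, then it is surjective. -/
theorem map_supported_sup_eq_top
    (h1 : ∀ u ∈ U, ∀ v ∈ V, d (Finsupp.single u 1) v ≠ 0 → P u v ∨ b v < a u)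
    (h2 : ∀ u v, P u v → b v = a u ∧ IsUnit (d (Finsupp.single u 1) v))
    (h3 : ∀ v ∈ V, ∃ u ∈ U, P u v) (h4 : ∀ u v v', P u v → P u v' → v = v') :
    (Finsupp.supported ℤ ℤ U).map d ⊔ Finsupp.supported ℤ ℤ Vᶜ = ⊤ := by
  set S := (Finsupp.supported ℤ ℤ U).map d ⊔ Finsupp.supported ℤ ℤ Vᶜ with hS
  have hout : ∀ v ∉ V, ∀ m : ℤ, Finsupp.single v m ∈ S := fun v hv m =>
    Submodule.mem_sup_right (Finsupp.single_mem_supported ℤ m hv)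
  have hin : ∀ r : ρ, ∀ v ∈ V, b v = r → ∀ m : ℤ, Finsupp.single v m ∈ S := by
    intro r
    induction r using WellFoundedLT.induction with
    | ind r ih =>
      intro v hv hr m
      obtain ⟨u, hu, hP⟩ := h3 v hv
      obtain ⟨hb, hunit⟩ := h2 u v hP
      have hd : d (Finsupp.single u 1) ∈ S :=
        Submodule.mem_sup_left (Submodule.mem_map_of_mem (Finsupp.single_mem_supported ℤ 1 hu))
      -- Apart from `v`, the image of its partner `u` involves only elements outside `V` and
      -- elements of `V` of smaller rank, which are covered by the induction.
      have hrest : (d (Finsupp.single u 1)).erase v ∈ S := by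
        rw [← Finsupp.sum_single ((d (Finsupp.single u 1)).erase v)]
        refine Submodule.sum_mem _ fun w hw => ?_
        classical
        rw [Finsupp.support_erase, Finset.mem_erase, Finsupp.mem_support_iff] at hw
        by_cases hwV : w ∈ V
        · rcases h1 u hu w hwV hw.2 with h | h
          · exact absurd (h4 u w v h hP) hw.1
          · exact ih (b w) (by rwa [← hr, hb]) w hwV rfl _
        · exact hout w hwV _
      have hsingle : Finsupp.single v (d (Finsupp.single u 1) v) ∈ S := by
        have := Finsupp.single_add_erase v (d (Finsupp.single u 1))
        rw [← eq_sub_iff_add_eq] at this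
        rw [this]
        exact S.sub_mem hd hrest
      obtain ⟨e, he⟩ := hunit.exists_left_inv
      have := S.smul_mem (m * e) hsingle
      rwa [Finsupp.smul_single, smul_eq_mul, mul_assoc, he, mul_one] at this
  rw [eq_top_iff]
  intro z _
  rw [← Finsupp.sum_single z]
  refine Submodule.sum_mem _ fun v _ => ?_
  by_cases hv : v ∈ V
  · exact hin _ v hv rfl _
  · exact hout v hv _

omit [WellFoundedLT ρ] in
-- Take `u` of maximal rank in the support of `w`. The coefficient of `d w` at the partner of `u`
-- receives a contribution from `u` only, and that is a unit multiple of `w u`. A maximum exists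
-- since the support is finite.
theorem eq_zero_of_unitriangular
    (h1 : ∀ u ∈ U, ∀ v ∈ V, d (Finsupp.single u 1) v ≠ 0 → P u v ∨ b v < a u)
    (h2 : ∀ u v, P u v → b v = a u ∧ IsUnit (d (Finsupp.single u 1) v))
    (h3 : ∀ u ∈ U, ∃ v ∈ V, P u v) (h4 : ∀ u u' v, P u v → P u' v → u = u')
    {w : α →₀ ℤ} (hw : w ∈ Finsupp.supported ℤ ℤ U) (hd : ∀ v ∈ V, d w v = 0) : w = 0 := by
  by_contra hne
  obtain ⟨u, hu, hmax⟩ := w.support.exists_max_image a (Finsupp.support_nonempty_iff.2 hne)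
  have hsub : (w.support : Set α) ⊆ U := hw
  obtain ⟨v, hv, hP⟩ := h3 u (hsub hu)
  obtain ⟨hb, hunit⟩ := h2 u v hP
  have h0 := hd v hv
  have hsum : d w v = ∑ x ∈ w.support, w x * d (Finsupp.single x 1) v := by
    conv_lhs => rw [← Finsupp.sum_single w, Finsupp.sum, map_sum, Finsupp.finsetSum_apply]
    refine Finset.sum_congr rfl fun x _ => ?_
    rw [← Finsupp.smul_single_one, map_smul, Finsupp.smul_apply, smul_eq_mul]
  rw [hsum, Finset.sum_eq_single u] at h0
  · rcases mul_eq_zero.1 h0 with h | h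
    · exact Finsupp.mem_support_iff.1 hu h
    · rw [h] at hunit
      exact not_isUnit_zero hunit
  · intro x hx hxu
    by_cases hz : d (Finsupp.single x 1) v = 0
    · rw [hz, mul_zero]
    · rcases h1 x (hsub hx) v hv hz with h | h
      · exact absurd (h4 x u v h hP) hxu
      · exact absurd (hmax x hx) (not_le.2 (hb ▸ h))
  · exact fun h => absurd hu h
end

/-! ### The matching of upper and lower domains -/

/-- The matching of upper domains with lower domains: remove the thin initial rectangle along the
splitting line. -/
def Matches {k : ℕ} (D : Basis n (k + 1)) (E : Basis n k) : Prop :=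
  ∃ l, D.1.line = some l ∧ Ascends D.1.src l ∧
    ∃ h : (thin D.1.src l).IsInitial D.1, E = D.removeInitial _ h

theorem Matches.isUpper {k : ℕ} {D : Basis n (k + 1)} {E : Basis n k} (h : Matches D E) :
    D.1.IsUpper := by
  obtain ⟨l, h1, h2, -⟩ := h
  exact ⟨l, h1, h2⟩

theorem line_removeInitial_thin {D : PosDomain n} {l : Line n} (ha : Ascends D.src l)
    (h : (thin D.src l).IsInitial D) : (D.removeInitial _ h).line = D.line :=
  PosDomain.line_eq_of_isPlanar (R := thin D.src l) rfl (fun _ _ => rfl) (thin_isPlanar ha)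

theorem Matches.isLower {k : ℕ} {D : Basis n (k + 1)} {E : Basis n k} (h : Matches D E) :
    E.1.IsLower := by
  obtain ⟨l, h1, h2, h3, rfl⟩ := h
  exact ⟨l, (line_removeInitial_thin h2 h3).trans h1,
    fun hh => (ascends_thin_tgt _ _).1 hh h2⟩

theorem exists_matches_of_isUpper {k : ℕ} {D : Basis n (k + 1)} (h : D.1.IsUpper) :
    ∃ E : Basis n k, Matches D E := by
  obtain ⟨l, h1, h2⟩ := h
  exact ⟨_, l, h1, h2, ⟨thin_src _ _, thin_le h1 h2⟩, rfl⟩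

/-- Prepending the thin rectangle that ends at the initial state of `E` gives the partner: it is
planar, so the splitting line stays the same. -/
theorem exists_matches_of_isLower {k : ℕ} {E : Basis n k} (h : E.1.IsLower) :
    ∃ D : Basis n (k + 1), Matches D E := by
  obtain ⟨l, h1, h2⟩ := h
  let D := Basis.prepend _ E (thinTo_tgt E.1.src l)
  have hsrc : D.1.src = (thin E.1.src l).tgt := thin_src _ _
  have hthin : thin D.1.src l = thinTo E.1.src l := by rw [hsrc]; rfl
  have ha : Ascends D.1.src l := by rw [hsrc]; exact (ascends_thin_tgt _ _).2 h2
  have hi : (thin D.1.src l).IsInitial D.1 := by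
    rw [hthin]
    exact ⟨rfl, fun c r => le_add_of_nonneg_left (E.1.nonneg c r)⟩
  have hE : E.1 = D.1.removeInitial _ hi := by
    refine PosDomain.ext ?_ rfl ?_
    · change _ = (thin D.1.src l).tgt
      rw [hthin, thinTo_tgt]
    · funext c r
      change E.1.chain c r = E.1.chain c r + (thinTo E.1.src l).chain c r -
        (thin D.1.src l).chain c r
      rw [hthin, add_sub_cancel_right]
  have hl : D.1.line = some l := by
    rw [← h1, ← line_removeInitial_thin ha hi, ← hE]
  exact ⟨D, l, hl, ha, hi, Subtype.ext hE⟩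

/-- The removed rectangle can be recovered from `E`: its line is the splitting line of `E`, and
`thin_thin_tgt` recovers its initial state. -/
theorem Matches.left_unique {k : ℕ} {D D' : Basis n (k + 1)} {E : Basis n k} (h : Matches D E)
    (h' : Matches D' E) : D = D' := by
  obtain ⟨l, h1, h2, h3, rfl⟩ := h
  obtain ⟨l', h1', h2', h3', h4⟩ := h'
  have hl : l = l' := by
    have e1 := (line_removeInitial_thin h2 h3).trans h1
    have e2 := (line_removeInitial_thin h2' h3').trans h1'
    rw [show D.1.removeInitial _ h3 = D'.1.removeInitial _ h3' from congrArg Subtype.val h4,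
      e2] at e1
    exact (Option.some.inj e1).symm
  subst hl
  have ht : (thin D.1.src l).tgt = (thin D'.1.src l).tgt :=
    congrArg (fun E : Basis n k => E.1.src) h4
  have hs : D.1.src = D'.1.src := by
    rw [← thin_thin_tgt D.1.src l, ht, thin_thin_tgt]
  refine Subtype.ext (PosDomain.ext hs (congrArg (fun E : Basis n k => E.1.tgt) h4) ?_)
  funext c r
  have hc : D.1.chain c r - (thin D.1.src l).chain c r =
      D'.1.chain c r - (thin D'.1.src l).chain c r :=
    congrArg (fun E : Basis n k => E.1.chain c r) h4
  rw [hs] at hc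
  exact sub_left_injective hc

theorem Matches.right_unique {k : ℕ} {D : Basis n (k + 1)} {E E' : Basis n k} (h : Matches D E)
    (h' : Matches D E') : E = E' := by
  obtain ⟨l, h1, h2, h3, rfl⟩ := h
  obtain ⟨l', h1', h2', h3', rfl⟩ := h'
  obtain rfl := Option.some.inj (h1.symm.trans h1')
  rfl

theorem Matches.rank_eq {k : ℕ} {D : Basis n (k + 1)} {E : Basis n k} (h : Matches D E) :
    E.1.rank = D.1.rank := by
  obtain ⟨l, h1, h2, h3, rfl⟩ := h
  exact rank_eq_of_isPlanar (R := thin D.1.src l) rfl (fun _ _ => rfl) (thin_isPlanar h2)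

theorem removeFinal_ne_of_not_rank_lt {k : ℕ} {D : Basis n (k + 1)} {E : Basis n k}
    (h : ¬ E.1.rank < D.1.rank) {R : Rect n} (hR : R.IsFinal D.1) : D.removeFinal R hR ≠ E := by
  rintro rfl
  exact h (rank_removeFinal_lt hR)

/-- Only the thin rectangle contributes, with its sign: any other removal that ends in a lower
domain, or any final removal, lowers the rank, while matched domains have equal rank. -/
theorem deltaBasis_apply_of_matches (s : SignAssignment n) {k : ℕ} {D : Basis n (k + 1)}
    {E : Basis n k} (h : Matches D E) : IsUnit (deltaBasis s k D E) := by
  have hE := h.isLower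
  have hr := h.rank_eq
  obtain ⟨l, h1, h2, h3, h4⟩ := h
  rw [deltaBasis, Finsupp.add_apply, Finsupp.smul_apply, Finsupp.finsetSum_apply,
    Finsupp.finsetSum_apply, Finset.sum_eq_single (thin D.1.src l),
    Finset.sum_eq_zero, smul_zero, add_zero, dif_pos h3, h4, Finsupp.single_eq_same]
  · exact Units.isUnit _
  · intro R _
    split_ifs with hR
    · exact Finsupp.single_eq_of_ne
        (removeFinal_ne_of_not_rank_lt (by rw [hr]; exact lt_irrefl _) hR).symm
    · rfl
  · intro R _ hne
    split_ifs with hR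
    · refine Finsupp.single_eq_of_ne ?_
      rintro rfl
      rcases eq_thin_or_rank_lt h1 h2 hR hE with h | h
      · exact hne h
      · exact absurd h (by change ¬ (D.removeInitial R hR).1.rank < _; rw [hr]; exact lt_irrefl _)
    · rfl
  · exact fun h => absurd (Finset.mem_univ _) h

theorem matches_or_rank_lt (s : SignAssignment n) {k : ℕ} {D : Basis n (k + 1)}
    {E : Basis n k} (hD : D.1.IsUpper) (hE : E.1.IsLower) (h : deltaBasis s k D E ≠ 0) :
    Matches D E ∨ E.1.rank < D.1.rank := by
  obtain ⟨l, h1, h2⟩ := hD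
  by_contra hc
  push Not at hc
  refine h ?_
  rw [deltaBasis, Finsupp.add_apply, Finsupp.smul_apply, Finsupp.finsetSum_apply,
    Finsupp.finsetSum_apply, Finset.sum_eq_zero, Finset.sum_eq_zero, smul_zero, add_zero]
  · intro R _
    split_ifs with hR
    · exact Finsupp.single_eq_of_ne (removeFinal_ne_of_not_rank_lt (not_lt.2 hc.2) hR).symm
    · rfl
  · intro R _
    split_ifs with hR
    · refine Finsupp.single_eq_of_ne ?_
      rintro rfl
      rcases eq_thin_or_rank_lt h1 h2 hR hE with h | h
      · subst h
        exact hc.1 ⟨l, h1, h2, hR, rfl⟩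
      · exact absurd h (not_lt.2 hc.2)
    · rfl

theorem isUpper_or_isLower_or_eq_const (D : PosDomain n) :
    D.IsUpper ∨ D.IsLower ∨ D = PosDomain.const (Equiv.refl (Fin n)) := by
  cases h : D.line with
  | none => exact .inr (.inr (eq_const_of_line_eq_none h))
  | some l =>
    by_cases ha : Ascends D.src l
    · exact .inl ⟨l, h, ha⟩
    · exact .inr (.inl ⟨l, h, ha⟩)

theorem not_isLower_const : ¬ (PosDomain.const (Equiv.refl (Fin n))).IsLower := by
  rintro ⟨l, h, -⟩
  rw [line_const] at h
  exact absurd h (by simp)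

/-! ### Cycles and boundaries -/

theorem delta_single_of_matches (s : SignAssignment n) {k : ℕ} (D : Basis n (k + 1))
    (E : Basis n k) (h : Matches D E) :
    E.1.rank = D.1.rank ∧ IsUnit (delta s k (Finsupp.single D 1) E) :=
  ⟨h.rank_eq, by rw [delta_single]; exact deltaBasis_apply_of_matches s h⟩

/-- Surjectivity of the upper-to-lower part of `δ`: modulo boundaries, no lower domains are needed.
-/
theorem exists_delta_add (s : SignAssignment n) (k : ℕ) (z : CD n k) :
    ∃ (w : CD n (k + 1)) (u : CD n k), delta s k w + u = z ∧
      ∀ D ∈ u.support, ¬ D.1.IsLower := by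
  have hz : z ∈ (⊤ : Submodule ℤ (CD n k)) := Submodule.mem_top
  rw [← map_supported_sup_eq_top (U := {D : Basis n (k + 1) | D.1.IsUpper})
    (V := {E : Basis n k | E.1.IsLower}) (P := Matches) (a := fun D => D.1.rank)
    (b := fun D => D.1.rank) (d := delta s k)
    (fun u hu v hv h => matches_or_rank_lt s hu hv (by rwa [delta_single] at h))
    (fun u v h => delta_single_of_matches s u v h)
    (fun v hv => (exists_matches_of_isLower hv).imp fun _ h => ⟨h.isUpper, h⟩)
    (fun _ _ _ h h' => h.right_unique h')] at hz
  obtain ⟨_, ⟨w, -, rfl⟩, u, hu, rfl⟩ := Submodule.mem_sup.1 hz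
  exact ⟨w, u, rfl, fun D hD => hu hD⟩

theorem eq_zero_of_delta_lower_eq_zero (s : SignAssignment n) (k : ℕ) {w : CD n (k + 1)}
    (hw : ∀ D ∈ w.support, D.1.IsUpper) (h : ∀ E : Basis n k, E.1.IsLower → delta s k w E = 0) :
    w = 0 :=
  eq_zero_of_unitriangular (U := {D : Basis n (k + 1) | D.1.IsUpper})
    (V := {E : Basis n k | E.1.IsLower}) (P := Matches) (a := fun D => D.1.rank)
    (b := fun D => D.1.rank) (d := delta s k)
    (fun u hu v hv h => matches_or_rank_lt s hu hv (by rwa [delta_single] at h))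
    (fun u v h => delta_single_of_matches s u v h)
    (fun u hu => (exists_matches_of_isUpper hu).imp fun _ h => ⟨h.isLower, h⟩)
    (fun _ _ _ h h' => h.left_unique h') (fun D hD => hw D hD) h

theorem isUpper_of_not_isLower {k : ℕ} {D : Basis n (k + 1)} (h : ¬ D.1.IsLower) :
    D.1.IsUpper := by
  rcases isUpper_or_isLower_or_eq_const D.1 with h1 | h1 | h1
  · exact h1
  · exact absurd h1 h
  · have h2 := D.2
    rw [h1, PosDomain.maslov_const] at h2
    exact absurd (Nat.cast_injective h2) (Nat.succ_ne_zero k).symm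

/-- Removing the thin rectangle would leave a positive domain of index `-1`. -/
theorem not_isUpper_zero (D : Basis n 0) : ¬ D.1.IsUpper := by
  rintro ⟨l, h1, h2⟩
  have h := D.1.maslov_removeInitial _ ⟨thin_src _ _, thin_le h1 h2⟩
  have h0 := (D.1.removeInitial _ ⟨thin_src _ _, thin_le h1 h2⟩).maslov_nonneg
  rw [D.2] at h
  push_cast at h
  linarith

/-- Modulo a boundary, the cycle is supported on upper domains, as the trivial domain has degree
`0`. A cycle of upper domains vanishes by injectivity of the upper-to-lower part. -/
theorem exists_delta_eq (s : SignAssignment n) (k : ℕ) {z : CD n (k + 1)} (hz : delta s k z = 0) :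
    ∃ w, delta s (k + 1) w = z := by
  obtain ⟨w, u, rfl, hu⟩ := exists_delta_add s (k + 1) z
  have h0 : delta s k u = 0 := by
    have h1 := LinearMap.congr_fun (delta_comp_delta s k) w
    rw [LinearMap.comp_apply, LinearMap.zero_apply] at h1
    rwa [map_add, h1, zero_add] at hz
  refine ⟨w, ?_⟩
  rw [eq_zero_of_delta_lower_eq_zero s k (fun D hD => isUpper_of_not_isLower (hu D hD))
    (fun E _ => by rw [h0]; rfl), add_zero]

theorem exists_delta_zero_add (s : SignAssignment n) (z : CD n 0) :
    ∃ (m : ℤ) (w : CD n 1), delta s 0 w + m • constChain (Equiv.refl (Fin n)) = z := by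
  obtain ⟨w, u, rfl, hu⟩ := exists_delta_add s 0 z
  refine ⟨u ⟨PosDomain.const (Equiv.refl (Fin n)), PosDomain.maslov_const _⟩, w, ?_⟩
  congr 1
  rw [constChain, Finsupp.smul_single, smul_eq_mul, mul_one]
  symm
  refine Finsupp.eq_single_iff.2 ⟨fun D hD => ?_, rfl⟩
  rw [Finset.mem_singleton]
  rcases isUpper_or_isLower_or_eq_const D.1 with h | h | h
  · exact absurd h (not_isUpper_zero D)
  · exact absurd h (hu D hD)
  · exact Subtype.ext h

/-- Modulo a boundary, `w` is a combination of upper domains. The trivial domain at the identity is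
not lower, so the lower part of the boundary is zero, which forces this combination to vanish. -/
theorem eq_zero_of_delta_zero_eq (s : SignAssignment n) {m : ℤ} {w : CD n 1}
    (h : delta s 0 w = m • constChain (Equiv.refl (Fin n))) : m = 0 := by
  obtain ⟨w', u, rfl, hu⟩ := exists_delta_add s 1 w
  have h1 := LinearMap.congr_fun (delta_comp_delta s 0) w'
  rw [LinearMap.comp_apply, LinearMap.zero_apply] at h1
  rw [map_add, h1, zero_add] at h
  have hu0 : u = 0 := by
    refine eq_zero_of_delta_lower_eq_zero s 0 (fun D hD => isUpper_of_not_isLower (hu D hD)) ?_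
    intro E hE
    rw [h, constChain, Finsupp.smul_single]
    refine Finsupp.single_eq_of_ne ?_
    rintro rfl
    exact not_isLower_const hE
  rw [hu0, map_zero, constChain, Finsupp.smul_single, smul_eq_mul, mul_one] at h
  exact Finsupp.single_eq_zero.1 h.symm

/-! ### Homology of the complex -/

theorem complex_d (s : SignAssignment n) (h : ∀ k, delta s k ∘ₗ delta s (k + 1) = 0) (k : ℕ) :
    (complex s h).d (k + 1) k = ModuleCat.ofHom (delta s k) :=
  ChainComplex.of_d (fun k => ModuleCat.of ℤ (CD n k)) (fun k => ModuleCat.ofHom (delta s k)) k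

theorem isZero_homology (s : SignAssignment n) (h : ∀ k, delta s k ∘ₗ delta s (k + 1) = 0)
    (k : ℕ) : Limits.IsZero ((complex s h).homology (k + 1)) := by
  rw [← HomologicalComplex.exactAt_iff_isZero_homology,
    HomologicalComplex.exactAt_iff' _ (k + 2) (k + 1) k (by simp) (by simp),
    ShortComplex.moduleCat_exact_iff]
  intro z hz
  change (complex s h).d (k + 1) k z = 0 at hz
  rw [complex_d] at hz
  obtain ⟨w, hw⟩ := exists_delta_eq s k (z := z) hz
  refine ⟨w, ?_⟩
  change (complex s h).d (k + 1 + 1) (k + 1) w = z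
  rw [complex_d]
  exact hw

theorem exists_homology_zero_iso (s : SignAssignment n)
    (h : ∀ k, delta s k ∘ₗ delta s (k + 1) = 0) :
    ∃ (e : (complex s h).homology 0 ≅ ModuleCat.of ℤ ℤ) (z : (complex s h).cycles 0),
      (complex s h).iCycles 0 z = constChain (Equiv.refl (Fin n)) ∧
      e.hom ((complex s h).homologyπ 0 z) = (1 : ℤ) := by
  set K := complex s h with hK
  -- The outgoing differential in degree `0` is zero, so every chain there is a cycle.
  have : IsIso (K.iCycles 0) := K.isIso_iCycles 0 0 (by simp) (by
    rw [K.shape]; simp)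
  have hinj : Function.Injective (K.iCycles 0) :=
    (ModuleCat.mono_iff_injective _).1 inferInstance
  have hsurj : Function.Surjective (K.iCycles 0) :=
    (ModuleCat.epi_iff_surjective _).1 inferInstance
  have hπ : Function.Surjective (K.homologyπ 0) :=
    (ModuleCat.epi_iff_surjective _).1 inferInstance
  have hex : ∀ x : K.cycles 0, K.homologyπ 0 x = 0 ↔ ∃ w : CD n 1, delta s 0 w = K.iCycles 0 x := by
    have hc := (ShortComplex.moduleCat_exact_iff _).1 (ShortComplex.exact_of_g_is_cokernel
      (ShortComplex.mk _ _ (K.toCycles_comp_homologyπ 1 0)) (K.homologyIsCokernel 1 0 (by simp)))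
    have hd : ∀ w : CD n 1, K.iCycles 0 (K.toCycles 1 0 w) = delta s 0 w := fun w =>
      (congrArg (fun φ : K.X 1 ⟶ K.X 0 => φ.hom w) (K.toCycles_i 1 0)).trans
        (congrArg (fun φ : K.X 1 ⟶ K.X 0 => φ.hom w) (complex_d s h 0))
    intro x
    constructor
    · intro hx
      obtain ⟨w, hw⟩ := hc x hx
      exact ⟨w, (hd w).symm.trans (congrArg (K.iCycles 0) hw)⟩
    · rintro ⟨w, hw⟩
      rw [← hd] at hw
      rw [← hinj hw]
      exact congrArg (fun φ : K.X 1 ⟶ K.homology 0 => φ.hom w) (K.toCycles_comp_homologyπ 1 0)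
  obtain ⟨z, hz⟩ := hsurj (constChain (Equiv.refl (Fin n)))
  -- The inverse of the desired isomorphism: multiples of the class of the trivial domain.
  -- Injectivity is `eq_zero_of_delta_zero_eq`, surjectivity is `exists_delta_zero_add`.
  let f : ℤ →ₗ[ℤ] K.homology 0 := LinearMap.toSpanSingleton ℤ _ (K.homologyπ 0 z)
  have hf1 : f 1 = K.homologyπ 0 z := LinearMap.toSpanSingleton_apply_one ℤ _ _
  have hfm : ∀ m : ℤ, f m = m • K.homologyπ 0 z := fun m => by
    rw [← hf1, ← map_zsmul, zsmul_one, Int.cast_id]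
  have hf : Function.Bijective f := by
    constructor
    · refine (injective_iff_map_eq_zero f).2 fun m hm => ?_
      have hm' : K.homologyπ 0 (m • z) = 0 := by rw [map_zsmul, ← hfm]; exact hm
      obtain ⟨w, hw⟩ := (hex _).1 hm'
      rw [map_zsmul, hz] at hw
      exact eq_zero_of_delta_zero_eq s hw
    · intro y
      obtain ⟨x, rfl⟩ := hπ y
      obtain ⟨m, w, hw⟩ := exists_delta_zero_add s (K.iCycles 0 x)
      refine ⟨m, ?_⟩
      have h0 : K.homologyπ 0 (x - m • z) = 0 := by
        refine (hex _).2 ⟨w, ?_⟩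
        rw [map_sub, map_zsmul, hz]
        exact eq_sub_of_add_eq hw
      rw [map_sub, map_zsmul, sub_eq_zero] at h0
      exact (hfm m).trans h0.symm
  refine ⟨(LinearEquiv.ofBijective f hf).symm.toModuleIso, z, hz, ?_⟩
  change (LinearEquiv.ofBijective f hf).symm (K.homologyπ 0 z) = 1
  rw [LinearEquiv.symm_apply_eq]
  exact hf1.symm

end Grid

theorem proposition3p4 (n : ℕ) [NeZero n] (s : Grid.SignAssignment n) :
    -- every positive domain has a degree in `ℕ`
    (∀ D : Grid.PosDomain n, ∃ k : ℕ, D.maslov = k) ∧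
    -- `CD_*` is a chain complex, with homology `ℤ` in degree `0`
    ∃ h : ∀ k, Grid.delta s k ∘ₗ Grid.delta s (k + 1) = 0,
      (∀ k, k ≠ 0 → CategoryTheory.Limits.IsZero ((Grid.complex s h).homology k)) ∧
      -- generated by the class of the trivial domain at the identity state
      ∃ (e : (Grid.complex s h).homology 0 ≅ ModuleCat.of ℤ ℤ)
        (z : (Grid.complex s h).cycles 0),
        (Grid.complex s h).iCycles 0 z = Grid.constChain (Equiv.refl (Fin n)) ∧
        e.hom ((Grid.complex s h).homologyπ 0 z) = (1 : ℤ) := by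
  refine ⟨Grid.PosDomain.exists_maslov_eq, Grid.delta_comp_delta s, fun k hk => ?_,
    Grid.exists_homology_zero_iso s _⟩
  obtain ⟨k, rfl⟩ := Nat.exists_eq_succ_of_ne_zero hk
  exact Grid.isZero_homology s _ k
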